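/- **Setting.** A user sits at the origin of the plane. Base stations (SBSs) form a homogeneous Poisson point process $\Phi=\{x_i\}$ on $\mathbb R^2$ of intensity $\lambda>0$; put $r_i=\|x_i\|$. The area around each station is divided into $M\ge 1$ equal angular sections, with path loss exponents $\alpha_{i1},\dots,\alpha_{iM}$, and $\alpha_i$ denotes the exponent $\alpha_{im}$ of the section of $x_i$ that contains the user, that is, $\frac{2\pi}{M}(m-1)\le\Theta_i<\frac{2\pi}{M}m$, where $\Theta_i\in[0,2\pi)$ is the angle of the vector from $x_i$ to the origin. The power received from $x_i$ is $P_i=P_T\,G_i\,h_i\,r_i^{-\alpha_i}$ with $P_T>0$. All $\alpha_{im}$ are uniform on $[\mu-\sqrt3\sigma,\mu+\sqrt3\sigma]$ (mean $\mu$, standard deviation $\sigma>0$, with $\mu-\sqrt3\sigma>0$); the fadings $h_i$ are exponential with mean $1$; the antenna gains $G_i$ take the value $g_n$ with probability $p_n$ ($n=1,\dots,4$), where, for main and side lobe gains $M_t,M_r,m_t,m_r>0$ and lobe widths $\phi_t,\phi_r\in[0,2\pi]$, one has $(g_1,g_2,g_3,g_4)=(M_tM_r,\ M_tm_r,\ m_tM_r,\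 m_tm_r)$ and $p_1=\frac{\phi_t}{2\pi}\frac{\phi_r}{2\pi}$, $p_2=\frac{\phi_t}{2\pi}\left(1-\frac{\phi_r}{2\pi}\right)$, $p_3=\left(1-\frac{\phi_t}{2\pi}\right)\frac{\phi_r}{2\pi}$, $p_4=\left(1-\frac{\phi_t}{2\pi}\right)\left(1-\frac{\phi_r}{2\pi}\right)$. All of these variables are independent, and independent of $\Phi$. The user is served by the station with the maximum received power. For $r>0$ put $$P_A(r)=\sum_{m=1}^4\frac{p_m}{2\sqrt3\,\sigma}\int_0^\infty\int_{\mu-\sqrt3\sigma}^{\mu+\sqrt3\sigma}\exp\left(-h_r-\frac{\lambda\pi}{\sqrt3\,\sigma}\sum_{n=1}^4p_n\int_{\mu-\sqrt3\sigma}^{\mu+\sqrt3\sigma}\frac{\left(\frac{g_m}{g_n}h_r r^{-\alpha_r}\right)^{-2/\alpha_i}\Gamma\left(\frac2{\alpha_i}\right)}{\alpha_i}\,d\alpha_i\right)d\alpha_r\,dh_r .$$ **Theorem (association probability).** The probability that a base station at distance $r$ from the user is the serving one equals $P_A(r)$, in both of the following senses. 1. Let a station be placed at any fixed point at distance $r>0$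 from the origin, with antenna gain, fading and path loss exponents of the same laws, independent of $\Phi$ and of all variables attached to $\Phi$, and let $P(r)$ be the power received from it. Then $\Pr\{P_i\le P(r)\text{ for all }x_i\in\Phi\}=P_A(r)$. 2. $P_A(r)$ is the conditional (Palm) probability that a station of $\Phi$ serves the user, given that it is at distance $r$: for every Borel set $B\subseteq(0,\infty)$, $$\mathbb E\,\#\{i:\ r_i\in B,\ P_i=\max_j P_j\}=\int_B P_A(r)\,2\pi\lambda r\,dr .$$ -/

import Mathlib

open MeasureTheory ProbabilityTheory Set

noncomputable section

namespace SmallCell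

/-- The parameters of the network. -/
structure Params where
  /-- intensity of the Poisson process of base stations -/
  lam : ℝ
  /-- mean of the path loss exponent -/
  mu : ℝ
  /-- standard deviation of the path loss exponent -/
  sd : ℝ
  /-- common transmission power -/
  PT : ℝ
  /-- main lobe gain of a base station -/
  mainT : ℝ
  /-- main lobe gain of the user -/
  mainR : ℝ
  /-- side lobe gain of a base station -/
  sideT : ℝ
  /-- side lobe gain of the user -/
  sideR : ℝ
  /-- lobe width (in radians) of a base station -/
  phiT : ℝ
  /-- lobe width (in radians) of the user -/
  phiR : ℝ
  /-- number of angular sections around each base station -/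
  M : ℕ
  lam_pos : 0 < lam
  sd_pos : 0 < sd
  /-- the smallest possible path loss exponent is positive -/
  exponent_pos : 0 < mu - √3 * sd
  PT_pos : 0 < PT
  mainT_pos : 0 < mainT
  mainR_pos : 0 < mainR
  sideT_pos : 0 < sideT
  sideR_pos : 0 < sideR
  phiT_mem : phiT ∈ Icc 0 (2 * Real.pi)
  phiR_mem : phiR ∈ Icc 0 (2 * Real.pi)
  M_pos : 0 < M

namespace Params

variable (p : Params)

/-- The lower end of the range of the path loss exponent. -/
def lo : ℝ := p.mu - √3 * p.sd

/-- The upper end of the range of the path loss exponent. -/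
def hi : ℝ := p.mu + √3 * p.sd

/-- The four antenna gains. -/
def gain : Fin 4 → ℝ :=
  ![p.mainT * p.mainR, p.mainT * p.sideR, p.sideT * p.mainR, p.sideT * p.sideR]

/-- The probabilities of the four antenna gains. -/
def gainProb : Fin 4 → ℝ :=
  ![p.phiT / (2 * Real.pi) * (p.phiR / (2 * Real.pi)),
    p.phiT / (2 * Real.pi) * (1 - p.phiR / (2 * Real.pi)),
    (1 - p.phiT / (2 * Real.pi)) * (p.phiR / (2 * Real.pi)),
    (1 - p.phiT / (2 * Real.pi)) * (1 - p.phiR / (2 * Real.pi))]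

/-- The law of an antenna gain. -/
def gainLaw : Measure ℝ :=
  ∑ n : Fin 4, ENNReal.ofReal (p.gainProb n) • Measure.dirac (p.gain n)

/-- The law of a path loss exponent: uniform on the interval from `lo` to `hi`. -/
def exponentLaw : Measure ℝ := ProbabilityTheory.cond volume (Icc p.lo p.hi)

/-- What a base station carries besides its location: the antenna gain, the fading power gain,
and the path loss exponents of its `M` angular sections. -/
abbrev Mark : Type := ℝ × ℝ × (Fin p.M → ℝ)

/-- The law of the mark of a base station: the antenna gain, the fading (exponential with mean 1)
and the exponents of the sections are independent. -/
def markLaw : Measure p.Mark :=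
  p.gainLaw.prod ((expMeasure 1).prod (Measure.pi fun _ : Fin p.M => p.exponentLaw))

end Params

/-- The polar angle in `[0, 2π)` of a point of the plane. -/
def polarAngle (x : ℂ) : ℝ := if 0 ≤ x.arg then x.arg else x.arg + 2 * Real.pi

/-- The angle in `[0, 2π)` of the vector that points from a base station at `x` to the user at the
origin. -/
def userAngle (x : ℂ) : ℝ :=
  if polarAngle x < Real.pi then polarAngle x + Real.pi else polarAngle x - Real.pi

theorem userAngle_lt (x : ℂ) : userAngle x < 2 * Real.pi := by
  have h1 := Complex.arg_le_pi x
  have h2 := Real.pi_pos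
  unfold userAngle polarAngle
  split_ifs <;> linarith

namespace Params

variable (p : Params)

/-- The angular section of a base station at `x` that contains the user. With sections counted
from `0`, it is the `m` with `2π m / M ≤ userAngle x < 2π (m + 1) / M`. -/
def sectionOf (x : ℂ) : Fin p.M :=
  ⟨⌊(p.M : ℝ) * userAngle x / (2 * Real.pi)⌋₊, by
    have h2 : (0 : ℝ) < 2 * Real.pi := by positivity
    have hM : (0 : ℝ) < p.M := by exact_mod_cast p.M_pos
    rw [Nat.floor_lt' p.M_pos.ne', div_lt_iff₀ h2]
    exact mul_lt_mul_of_pos_left (userAngle_lt x) hM⟩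

/-- The power received at the origin from a base station at `x` with mark `a`. -/
def power (x : ℂ) (a : p.Mark) : ℝ :=
  p.PT * a.1 * a.2.1 * ‖x‖ ^ (-(a.2.2 (p.sectionOf x)))

/-- The integral expression for the association probability at distance `r`. -/
def assocFormula (r : ℝ) : ℝ :=
  ∑ m : Fin 4, p.gainProb m / (2 * √3 * p.sd) *
    ∫ h in Ioi (0 : ℝ), ∫ α in p.lo..p.hi,
      Real.exp (-h - p.lam * Real.pi / (√3 * p.sd) *
        ∑ n : Fin 4, p.gainProb n *
          ∫ β in p.lo..p.hi,
            (p.gain m / p.gain n * h * r ^ (-α)) ^ (-(2 / β)) * Real.Gamma (2 / β) / β)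

end Params

/-- The points `X 0, X 1, …` of the plane form a homogeneous Poisson point process of intensity
`lam`: the numbers of points in disjoint sets of finite area are independent Poisson variables
whose means are `lam` times the areas. -/
structure IsPoissonProcess {Ω : Type*} [MeasurableSpace Ω] (P : Measure Ω) (lam : ℝ)
    (X : ℕ → Ω → ℂ) : Prop where
  measurable : ∀ i, Measurable (X i)
  counts : ∀ (n : ℕ) (B : Fin n → Set ℂ), (∀ j, MeasurableSet (B j)) →
    (∀ j, volume (B j) ≠ ⊤) → Pairwise (fun j k => Disjoint (B j) (B k)) →
    ∀ k : Fin n → ℕ,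
      P {ω | ∀ j, {i | X i ω ∈ B j}.encard = (k j : ℕ∞)} =
        ∏ j, poissonMeasure (lam * (volume (B j)).toReal).toNNReal {k j}

/-- The random network: the base stations `X i` form a Poisson process, and carry i.i.d. marks
that are independent of all locations. -/
structure IsNetwork (p : Params) {Ω : Type*} [MeasurableSpace Ω] (P : Measure Ω)
    (X : ℕ → Ω → ℂ) (mark : ℕ → Ω → p.Mark) : Prop where
  poisson : IsPoissonProcess P p.lam X
  measurable_mark : ∀ i, Measurable (mark i)
  law_mark : ∀ i, P.map (mark i) = p.markLaw
  indep_marks : iIndepFun mark P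
  indep_locations : IndepFun (fun ω i => X i ω) (fun ω i => mark i ω) P

/-- `mark₀` is the mark of an additional base station: it has the common law of the marks and is
independent of the locations and marks of all other stations. -/
structure IsExtraMark (p : Params) {Ω : Type*} [MeasurableSpace Ω] (P : Measure Ω)
    (X : ℕ → Ω → ℂ) (mark : ℕ → Ω → p.Mark) (mark₀ : Ω → p.Mark) : Prop where
  measurable : Measurable mark₀
  law : P.map mark₀ = p.markLaw
  indep : IndepFun mark₀ (fun ω i => (X i ω, mark i ω)) P

end SmallCell

end

/-!
The stations with their marks form a Poisson process on the product of the plane and the mark space,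
with intensity `λ dx ⊗ markLaw`. Received power is a function on this product, so the number of
stations from which more than `t > 0` is received is a Poisson variable, and no station exceeds `t`
with probability `exp (-Λ t)`, where `Λ t = meanAbove t` is the mean of that number. Integrating
first over the location, for fixed gain `g`, fading `h` and exponent `β`, gives the area
`π (P_T g h / t) ^ (2 / β)` of a disc, and the integral over `h` then gives a Gamma function
(`Params.intensity_lt_power`). Only the section facing the user matters, and its exponent has the
same law for every location (`Params.lintegral_markLaw`). A station added at a point of norm `r` has
a random power `t`, independent of the network; averaging `exp (-Λ t)` over its mark is
`assocFormula r`, which is the first claim.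

The Poisson property is given through the joint law of the counts in disjoint sets. This yields the
Laplace functional for simple functions, and monotone limits extend it to all integrable functions
with values in `[0, 1]` (`IsPoissonProcess.lintegral_infProd`). Independence of the marks lets them
be integrated out factor by factor, which gives the Laplace functional of the marked process
(`IsNetwork.lintegral_infProd`).

The second claim is the Mecke formula for the points of maximal power. Differentiating the Laplace
functional gives, for disjoint `A` and `D`, the expected number of points in `A` on the event that
`D` is empty: the intensity of `A` times the void probability of `D`
(`IsNetwork.tsum_measure_mem_void`). Rounding powers up to a dyadic grid turns "no station is
stronger than this one" into such void events, one for each cell of the grid. Refining the grid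
gives the formula for the exact maximum (`IsNetwork.tsum_measure_mem_max`), in which ties need no
separate treatment, because the rounding is from above. Polar coordinates conclude.
-/

noncomputable section

namespace SmallCell

open Filter Topology
open scoped ENNReal NNReal

/-! ### Infinite products of factors at most one -/

/-- The infinite product of factors `f i ≤ 1`, as the infimum of the (decreasing) partial products.
An infimum is used rather than `tprod` because infima of products commute with decreasing limits
of the factors, without any summability condition. -/
def infProd (f : ℕ → ℝ≥0∞) : ℝ≥0∞ := ⨅ n, ∏ i ∈ Finset.range n, f i

theorem antitone_prod_range {f : ℕ → ℝ≥0∞} (hf : ∀ i, f i ≤ 1) :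
    Antitone fun n => ∏ i ∈ Finset.range n, f i := by
  refine antitone_nat_of_succ_le fun n => ?_
  rw [Finset.prod_range_succ]
  exact mul_le_of_le_one_right' (hf n)

theorem infProd_le_one (f : ℕ → ℝ≥0∞) : infProd f ≤ 1 :=
  (iInf_le _ 0).trans (by simp)

theorem measurable_infProd {Ω : Type*} [MeasurableSpace Ω] {f : Ω → ℕ → ℝ≥0∞}
    (hf : ∀ i, Measurable fun ω => f ω i) : Measurable fun ω => infProd (f ω) := by
  unfold infProd
  exact Measurable.iInf fun n => Finset.measurable_fun_prod _ fun i _ => hf i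

theorem lintegral_infProd {Ω : Type*} [MeasurableSpace Ω] {P : Measure Ω} [IsProbabilityMeasure P]
    {f : Ω → ℕ → ℝ≥0∞} (hf : ∀ i, Measurable fun ω => f ω i) (h1 : ∀ ω i, f ω i ≤ 1) :
    ∫⁻ ω, infProd (f ω) ∂P = ⨅ n, ∫⁻ ω, ∏ i ∈ Finset.range n, f ω i ∂P := by
  unfold infProd
  refine lintegral_iInf (fun n => Finset.measurable_fun_prod _ fun i _ => hf i)
    (fun m n h ω => antitone_prod_range (h1 ω) h) ?_
  simp

theorem infProd_eq_prod {f : ℕ → ℝ≥0∞} (hf : ∀ i, f i ≤ 1) (I : Finset ℕ)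
    (hI : ∀ i ∉ I, f i = 1) : infProd f = ∏ i ∈ I, f i := by
  apply le_antisymm
  · obtain ⟨n, hn⟩ := I.exists_nat_subset_range
    refine (iInf_le _ n).trans (le_of_eq ?_)
    exact (Finset.prod_subset hn fun i _ hi => hI i hi).symm
  · refine le_iInf fun n => ?_
    calc ∏ i ∈ I, f i = ∏ i ∈ I ∪ Finset.range n, f i :=
          Finset.prod_subset Finset.subset_union_left fun i _ hi => hI i hi
      _ ≤ ∏ i ∈ Finset.range n, f i := by
          rw [← Finset.prod_sdiff (Finset.subset_union_right (s₁ := I) (s₂ := Finset.range n))]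
          exact mul_le_of_le_one_left' (Finset.prod_le_one' fun i _ => hf i)

/-- Infinite products commute with decreasing limits of the factors. -/
theorem infProd_iInf {g : ℕ → ℕ → ℝ≥0∞} (hg : ∀ i, Antitone fun k => g k i)
    (h1 : ∀ k i, g k i ≤ 1) :
    infProd (fun i => ⨅ k, g k i) = ⨅ k, infProd (g k) := by
  unfold infProd
  rw [iInf_comm]
  congr 1 with n
  have ht : ∀ i, Tendsto (fun k => g k i) atTop (𝓝 (⨅ k, g k i)) := fun i =>
    tendsto_atTop_iInf (hg i)
  refine tendsto_nhds_unique
    (ENNReal.tendsto_finsetProd_of_ne_top (Finset.range n) (fun i _ => ht i) fun i _ => ?_)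
    (tendsto_atTop_iInf fun k l h => Finset.prod_le_prod' fun i _ => hg i h)
  exact ne_top_of_le_ne_top ENNReal.one_ne_top ((iInf_le _ 0).trans (h1 0 i))

/-! ### The Laplace functional of the Poisson process -/

/-- The probability generating function of the Poisson distribution. -/
theorem lintegral_one_sub_pow_poisson (m : ℝ≥0) {c : ℝ≥0∞} (hc : c ≤ 1) :
    ∫⁻ n : ℕ, (1 - c) ^ n ∂(poissonMeasure m) = ENNReal.ofReal (Real.exp (-(m * c.toReal))) := by
  have hc' : c ≠ ⊤ := ne_top_of_le_ne_top ENNReal.one_ne_top hc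
  have h0 : 0 ≤ 1 - c.toReal :=
    sub_nonneg.2 (by simpa using ENNReal.toReal_mono ENNReal.one_ne_top hc)
  have h1 : 1 - c = ENNReal.ofReal (1 - c.toReal) := by
    rw [ENNReal.ofReal_sub _ ENNReal.toReal_nonneg, ENNReal.ofReal_toReal hc', ENNReal.ofReal_one]
  have hs : HasSum (fun n : ℕ => Real.exp (-m) * (m : ℝ) ^ n / n.factorial * (1 - c.toReal) ^ n)
      (Real.exp (-(m * c.toReal))) := by
    have := (NormedSpace.expSeries_div_hasSum_exp ((m : ℝ) * (1 - c.toReal))).mul_left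
      (Real.exp (-m))
    rw [← Real.exp_eq_exp_ℝ, ← Real.exp_add] at this
    have h2 : -(m : ℝ) + m * (1 - c.toReal) = -(m * c.toReal) := by ring
    rw [h2] at this
    refine this.congr_fun fun n => ?_
    rw [mul_pow]
    ring
  rw [poissonMeasure, lintegral_sum_measure]
  simp_rw [lintegral_smul_measure, lintegral_dirac, smul_eq_mul, h1, ← ENNReal.ofReal_pow h0]
  rw [← hs.tsum_eq, ENNReal.ofReal_tsum_of_nonneg (fun n => by positivity) hs.summable]
  congr 1 with n
  rw [ENNReal.ofReal_mul (by positivity)]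

section Poisson

variable {Ω : Type*} [MeasurableSpace Ω] {P : Measure Ω} {lam : ℝ}
  {X : ℕ → Ω → ℂ}

theorem IsPoissonProcess.measurable_ncard (hX : IsPoissonProcess P lam X) {B : Set ℂ}
    (hB : MeasurableSet B) : Measurable fun ω => {i | X i ω ∈ B}.ncard :=
  _root_.measurable_ncard.comp (measurable_set_iff.2 fun i =>
    measurableSet_setOfPred.1 (hX.measurable i hB))

theorem IsPoissonProcess.ae_finite [IsProbabilityMeasure P]
    (hX : IsPoissonProcess P lam X) {B : Set ℂ}
    (hB : MeasurableSet B) (hfin : volume B ≠ ⊤) : ∀ᵐ ω ∂P, {i | X i ω ∈ B}.Finite := by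
  have hm : Measurable fun ω => {i | X i ω ∈ B}.encard :=
    measurable_encard.comp (measurable_set_iff.2 fun i =>
      measurableSet_setOfPred.1 (hX.measurable i hB))
  have hs : ∀ k : ℕ, MeasurableSet {ω | {i | X i ω ∈ B}.encard = (k : ℕ∞)} := fun k =>
    hm (measurableSet_singleton _)
  have key : P (⋃ k : ℕ, {ω | {i | X i ω ∈ B}.encard = (k : ℕ∞)}) = 1 := by
    rw [measure_iUnion _ hs]
    · have h := fun k : ℕ => hX.counts 1 (fun _ => B) (fun _ => hB) (fun _ => hfin)
        (fun j k h => (h (Subsingleton.elim _ _)).elim) fun _ => k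
      simp only [forall_const, Finset.univ_unique, Finset.prod_singleton] at h
      simp_rw [h]
      rw [← measure_univ (μ := poissonMeasure (lam * (volume B).toReal).toNNReal),
        ← Measure.tsum_indicator_apply_singleton _ _ MeasurableSet.univ]
      simp
    · intro k l hkl
      refine Set.disjoint_left.2 fun ω h1 h2 => hkl ?_
      exact_mod_cast (h1.symm.trans h2 : (k : ℕ∞) = l)
  have := (prob_compl_eq_zero_iff (MeasurableSet.iUnion hs)).2 key
  filter_upwards [measure_eq_zero_iff_ae_notMem.1 this] with ω hω
  obtain ⟨k, hk⟩ := mem_iUnion.1 (notMem_compl_iff.1 hω)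
  exact finite_of_encard_eq_coe hk

theorem IsPoissonProcess.map_ncard [IsProbabilityMeasure P]
    (hX : IsPoissonProcess P lam X) {ι : Type*} [Fintype ι] {B : ι → Set ℂ}
    (hB : ∀ j, MeasurableSet (B j)) (hfin : ∀ j, volume (B j) ≠ ⊤)
    (hd : Pairwise fun j k => Disjoint (B j) (B k)) :
    P.map (fun ω j => {i | X i ω ∈ B j}.ncard) =
      Measure.pi fun j => poissonMeasure (lam * (volume (B j)).toReal).toNNReal := by
  refine Measure.ext_of_singleton fun k => ?_
  rw [Measure.pi_singleton, Measure.map_apply (measurable_pi_lambda _ fun j =>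
    hX.measurable_ncard (hB j)) (measurableSet_singleton _)]
  let e := Fintype.equivFin ι
  have h := hX.counts _ (B ∘ e.symm) (fun j => hB _) (fun j => hfin _)
    (fun i j hij => hd (e.symm.injective.ne hij)) (k ∘ e.symm)
  rw [← e.symm.prod_comp]
  simp only [Function.comp_apply] at h
  rw [← h]
  refine measure_congr ?_
  filter_upwards [ae_all_iff.2 fun j => hX.ae_finite (hB j) (hfin j)] with ω hω
  refine propext ?_
  change (fun j => {i | X i ω ∈ B j}.ncard) = k ↔
    ∀ j, {i | X i ω ∈ B (e.symm j)}.encard = (k (e.symm j) : ℕ∞)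
  rw [funext_iff, ← e.symm.forall_congr_right]
  refine forall_congr' fun j => ?_
  rw [← (hω (e.symm j)).cast_ncard_eq]
  exact Nat.cast_inj.symm

theorem IsPoissonProcess.lintegral_prod_pow_ncard [IsProbabilityMeasure P]
    (hX : IsPoissonProcess P lam X)
    (hlam : 0 ≤ lam) {ι : Type*} [Fintype ι]
    {B : ι → Set ℂ} (hB : ∀ j, MeasurableSet (B j)) (hfin : ∀ j, volume (B j) ≠ ⊤)
    (hd : Pairwise fun j k => Disjoint (B j) (B k)) {c : ι → ℝ≥0∞} (hc : ∀ j, c j ≤ 1) :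
    ∫⁻ ω, ∏ j, (1 - c j) ^ {i | X i ω ∈ B j}.ncard ∂P =
      ENNReal.ofReal (Real.exp (-(lam * (∑ j, c j * volume (B j)).toReal))) := by
  have hmeas := fun j => hX.measurable_ncard (hB j)
  have hmap := hX.map_ncard hB hfin hd
  have hmap1 : ∀ j, P.map (fun ω => {i | X i ω ∈ B j}.ncard) =
      poissonMeasure (lam * (volume (B j)).toReal).toNNReal := by
    intro j
    have h := (measurePreserving_eval
      (fun j => poissonMeasure (lam * (volume (B j)).toReal).toNNReal) j).map_eq
    rw [← hmap, Measure.map_map (measurable_pi_apply j) (measurable_pi_lambda _ hmeas)] at h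
    exact h
  have hind : iIndepFun (fun j ω => {i | X i ω ∈ B j}.ncard) P := by
    rw [iIndepFun_iff_map_fun_eq_pi_map fun j => (hmeas j).aemeasurable, hmap]
    simp_rw [hmap1]
  have hind2 := hind.comp (fun j (n : ℕ) => (1 - c j) ^ n) fun j => Measurable.of_discrete
  have h2 := lintegral_prod_eq_prod_lintegral_of_indepFun Finset.univ _ hind2
    fun j => Measurable.of_discrete.comp (hmeas j)
  simp only [Function.comp_apply] at h2
  rw [h2]
  have h3 : ∀ j, ∫⁻ ω, (1 - c j) ^ {i | X i ω ∈ B j}.ncard ∂P =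
      ENNReal.ofReal (Real.exp (-(lam * (c j * volume (B j)).toReal))) := by
    intro j
    rw [← lintegral_map (f := fun n : ℕ => (1 - c j) ^ n) Measurable.of_discrete (hmeas j), hmap1,
      lintegral_one_sub_pow_poisson _ (hc j), Real.coe_toNNReal _ (by positivity),
      ENNReal.toReal_mul]
    ring_nf
  simp_rw [h3]
  rw [← ENNReal.ofReal_prod_of_nonneg fun _ _ => (Real.exp_pos _).le, ← Real.exp_sum,
    Finset.sum_neg_distrib, ← Finset.mul_sum, ENNReal.toReal_sum]
  exact fun j _ => ENNReal.mul_ne_top (ne_top_of_le_ne_top ENNReal.one_ne_top (hc j)) (hfin j)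

/-- The Laplace functional on simple functions: the product over all points factors into powers
whose exponents are the numbers of points in the level sets. -/
theorem IsPoissonProcess.lintegral_infProd_simpleFunc [IsProbabilityMeasure P]
    (hX : IsPoissonProcess P lam X)
    (hlam : 0 ≤ lam) (s : SimpleFunc ℂ ℝ≥0∞) (h1 : ∀ x, s x ≤ 1) (hs : s.lintegral volume ≠ ⊤) :
    ∫⁻ ω, infProd (fun i => 1 - s (X i ω)) ∂P =
      ENNReal.ofReal (Real.exp (-(lam * (∫⁻ x, s x).toReal))) := by
  classical
  let J : Finset ℝ≥0∞ := s.range.filter (· ≠ 0)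
  let B : J → Set ℂ := fun c => s ⁻¹' {c.1}
  have hB : ∀ j, MeasurableSet (B j) := fun j => s.measurableSet_fiber _
  have hfin : ∀ j, volume (B j) ≠ ⊤ := fun j =>
    ((SimpleFunc.FinMeasSupp.of_lintegral_ne_top hs).meas_preimage_singleton_ne_zero
      (Finset.mem_filter.1 j.2).2).ne
  have hd : Pairwise fun j k => Disjoint (B j) (B k) := fun j k hjk =>
    Set.disjoint_left.2 fun x hx hx' => hjk (Subtype.ext (hx.symm.trans hx'))
  have hc : ∀ j : J, j.1 ≤ 1 := fun j => by
    obtain ⟨x, hx⟩ := SimpleFunc.mem_range.1 (Finset.mem_filter.1 j.2).1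
    exact hx ▸ h1 x
  have hsum : ∑ j : J, j.1 * volume (B j) = ∫⁻ x, s x := by
    rw [SimpleFunc.lintegral_eq_lintegral, SimpleFunc.lintegral]
    refine (Finset.sum_coe_sort J fun c => c * volume (s ⁻¹' {c})).trans ?_
    exact Finset.sum_filter_of_ne fun c _ h => left_ne_zero_of_mul h
  rw [← hsum, ← hX.lintegral_prod_pow_ncard hlam hB hfin hd hc]
  refine lintegral_congr_ae ?_
  filter_upwards [ae_all_iff.2 fun j => hX.ae_finite (hB j) (hfin j)] with ω hω
  have hdisj : ((Finset.univ : Finset J) : Set J).PairwiseDisjoint fun j => (hω j).toFinset := by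
    intro j _ k _ hjk
    rw [Function.onFun, Finset.disjoint_left]
    intro i hi hi'
    simp only [Finite.mem_toFinset, mem_ofPred_eq] at hi hi'
    exact Set.disjoint_left.1 (hd hjk) hi hi'
  rw [infProd_eq_prod (fun i => tsub_le_self)
    (Finset.univ.biUnion fun j => (hω j).toFinset), Finset.prod_biUnion hdisj]
  · refine Finset.prod_congr rfl fun j _ => ?_
    rw [Finset.prod_congr rfl (g := fun _ => 1 - j.1), Finset.prod_const,
      ← ncard_eq_toFinset_card _ (hω j)]
    intro i hi
    simp only [Finite.mem_toFinset, mem_ofPred_eq] at hi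
    rw [show s (X i ω) = j.1 from hi]
  · intro i hi
    have : s (X i ω) = 0 := by
      by_contra h0
      refine hi (Finset.mem_biUnion.2 ⟨⟨s (X i ω), Finset.mem_filter.2 ⟨s.mem_range_self _, h0⟩⟩,
        Finset.mem_univ _, ?_⟩)
      simp [B]
    rw [this, tsub_zero]

/-- The **Laplace functional** of the Poisson process, in the form
`E ∏ i, (1 - u (X i)) = exp (-λ ∫ u)`. -/
theorem IsPoissonProcess.lintegral_infProd [IsProbabilityMeasure P]
    (hX : IsPoissonProcess P lam X)
    (hlam : 0 ≤ lam) {u : ℂ → ℝ≥0∞} (hu : Measurable u) (h1 : ∀ x, u x ≤ 1)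
    (hfin : ∫⁻ x, u x ≠ ⊤) :
    ∫⁻ ω, infProd (fun i => 1 - u (X i ω)) ∂P =
      ENNReal.ofReal (Real.exp (-(lam * (∫⁻ x, u x).toReal))) := by
  let s := SimpleFunc.eapprox u
  have hsu : ∀ n x, s n x ≤ u x := fun n x =>
    (le_iSup (fun n => s n x) n).trans_eq (SimpleFunc.iSup_eapprox_apply hu x)
  have hmono : ∀ x, Monotone fun n => s n x := fun x m n h => SimpleFunc.monotone_eapprox u h x
  have hanti : ∀ x, Antitone fun n => 1 - s n x := fun x m n h =>
    tsub_le_tsub_left (hmono x h) _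
  have hlint : ∀ n, ∫⁻ x, s n x ≠ ⊤ := fun n => ne_top_of_le_ne_top hfin (lintegral_mono (hsu n))
  have hprod : ∀ ω, infProd (fun i => 1 - u (X i ω)) =
      ⨅ n, infProd (fun i => 1 - s n (X i ω)) := by
    intro ω
    rw [← infProd_iInf (fun i => hanti _) fun k i => tsub_le_self]
    congr 1 with i
    rw [← SimpleFunc.iSup_eapprox_apply hu, ENNReal.sub_iSup ENNReal.one_ne_top]
  simp_rw [hprod]
  have hm : ∀ n, Measurable fun ω => infProd (fun i => 1 - s n (X i ω)) := fun n =>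
    measurable_infProd fun i => ((s n).measurable.comp (hX.measurable i)).const_sub _
  have hle : ∀ ω, Antitone fun n => infProd (fun i => 1 - s n (X i ω)) := fun ω m n h =>
    iInf_mono fun k => Finset.prod_le_prod' fun i _ => hanti _ h
  rw [lintegral_iInf hm (fun m n h ω => hle ω h)
    (ne_top_of_le_ne_top (b := 1) ENNReal.one_ne_top
      ((lintegral_mono fun ω => infProd_le_one _).trans (by simp)))]
  have hval : ∀ n, ∫⁻ ω, infProd (fun i => 1 - s n (X i ω)) ∂P =
      ENNReal.ofReal (Real.exp (-(lam * (∫⁻ x, s n x).toReal))) := fun n =>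
    hX.lintegral_infProd_simpleFunc hlam (s n) (fun x => (hsu n x).trans (h1 x))
      (SimpleFunc.lintegral_eq_lintegral (s n) volume ▸ hlint n)
  have ht1 : Tendsto (fun n => ∫⁻ ω, infProd (fun i => 1 - s n (X i ω)) ∂P) atTop
      (𝓝 (⨅ n, ∫⁻ ω, infProd (fun i => 1 - s n (X i ω)) ∂P)) :=
    tendsto_atTop_iInf fun m n h => lintegral_mono fun ω => hle ω h
  have ht2 : Tendsto (fun n => ∫⁻ x, s n x) atTop (𝓝 (∫⁻ x, u x)) := by
    have := lintegral_iSup (μ := (volume : Measure ℂ)) (f := fun n x => s n x)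
      (fun n => (s n).measurable) (fun m n h x => hmono x h)
    simp_rw [s, SimpleFunc.iSup_eapprox_apply hu] at this
    rw [this]
    exact tendsto_atTop_iSup fun m n h => lintegral_mono fun x => hmono x h
  refine tendsto_nhds_unique ht1 ?_
  simp_rw [hval]
  refine ENNReal.tendsto_ofReal ((Real.continuous_exp.tendsto _).comp (Tendsto.neg ?_))
  exact ((ENNReal.tendsto_toReal hfin).comp ht2).const_mul lam

end Poisson

/-! ### The laws of the marks -/

namespace Params

variable (p : Params)

theorem gain_pos (n : Fin 4) : 0 < p.gain n := by
  have h1 := p.mainT_pos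
  have h2 := p.mainR_pos
  have h3 := p.sideT_pos
  have h4 := p.sideR_pos
  fin_cases n <;> simp only [gain] <;> simp <;> positivity

theorem gainProb_nonneg (n : Fin 4) : 0 ≤ p.gainProb n := by
  have h2 : (0 : ℝ) < 2 * Real.pi := by positivity
  have hT0 : 0 ≤ p.phiT / (2 * Real.pi) := div_nonneg p.phiT_mem.1 h2.le
  have hR0 : 0 ≤ p.phiR / (2 * Real.pi) := div_nonneg p.phiR_mem.1 h2.le
  have hT1 : 0 ≤ 1 - p.phiT / (2 * Real.pi) := sub_nonneg.2 ((div_le_one h2).2 p.phiT_mem.2)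
  have hR1 : 0 ≤ 1 - p.phiR / (2 * Real.pi) := sub_nonneg.2 ((div_le_one h2).2 p.phiR_mem.2)
  fin_cases n
  exacts [mul_nonneg hT0 hR0, mul_nonneg hT0 hR1, mul_nonneg hT1 hR0, mul_nonneg hT1 hR1]

theorem sum_gainProb : ∑ n, p.gainProb n = 1 := by
  simp only [gainProb, Fin.sum_univ_four]
  simp
  ring

theorem lo_pos : 0 < p.lo := p.exponent_pos

theorem hi_sub_lo : p.hi - p.lo = 2 * √3 * p.sd := by
  unfold hi lo
  ring

theorem hi_sub_lo_pos : 0 < p.hi - p.lo := by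
  rw [hi_sub_lo]
  have := p.sd_pos
  positivity

theorem lintegral_gainLaw {f : ℝ → ℝ≥0∞} :
    ∫⁻ g, f g ∂p.gainLaw = ∑ n, ENNReal.ofReal (p.gainProb n) * f (p.gain n) := by
  simp [gainLaw, lintegral_finsetSum_measure]

instance : IsProbabilityMeasure p.gainLaw where
  measure_univ := by
    rw [← lintegral_one, lintegral_gainLaw]
    simp_rw [mul_one]
    rw [← ENNReal.ofReal_sum_of_nonneg fun n _ => p.gainProb_nonneg n, sum_gainProb,
      ENNReal.ofReal_one]

instance : IsProbabilityMeasure p.exponentLaw := by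
  have h : volume (Icc p.lo p.hi) ≠ 0 := by
    rw [Real.volume_Icc]
    exact (ENNReal.ofReal_pos.2 p.hi_sub_lo_pos).ne'
  exact cond_isProbabilityMeasure_of_finite h measure_Icc_lt_top.ne

instance : IsProbabilityMeasure p.markLaw := by
  have := isProbabilityMeasure_expMeasure one_pos
  unfold markLaw
  infer_instance

/-- The intensity measure of the marked process of base stations. -/
def intensity : Measure (ℂ × p.Mark) :=
  p.lam.toNNReal • (volume : Measure ℂ).prod p.markLaw

instance : SigmaFinite p.intensity := by
  have : SigmaFinite ((volume : Measure ℂ).prod p.markLaw) := Measure.prod.instSigmaFinite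
  unfold intensity
  infer_instance

theorem lintegral_intensity {f : ℂ × p.Mark → ℝ≥0∞} (hf : Measurable f) :
    ∫⁻ y, f y ∂p.intensity = ENNReal.ofReal p.lam * ∫⁻ x, ∫⁻ a, f (x, a) ∂p.markLaw := by
  rw [intensity, lintegral_smul_measure, lintegral_prod _ hf.aemeasurable]
  rfl

end Params

/-! ### The Laplace functional of the marked process -/

section Network

variable {p : Params} {Ω : Type*} [MeasurableSpace Ω] {P : Measure Ω}
  {X : ℕ → Ω → ℂ} {mark : ℕ → Ω → p.Mark}

theorem IsNetwork.measurable_pair (h : IsNetwork p P X mark) (i : ℕ) :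
    Measurable fun ω => (X i ω, mark i ω) :=
  (h.poisson.measurable i).prodMk (h.measurable_mark i)

/-- Given the locations, the factors are independent, so the marks can be integrated out factor by
factor. -/
theorem IsNetwork.lintegral_prod_range [IsProbabilityMeasure P] (h : IsNetwork p P X mark)
    {v : ℂ × p.Mark → ℝ≥0∞} (hv : Measurable v) (n : ℕ) :
    ∫⁻ ω, ∏ i ∈ Finset.range n, v (X i ω, mark i ω) ∂P =
      ∫⁻ ω, ∏ i ∈ Finset.range n, ∫⁻ a, v (X i ω, a) ∂p.markLaw ∂P := by
  have hX : Measurable fun ω i => X i ω := measurable_pi_lambda _ h.poisson.measurable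
  have hm : Measurable fun ω i => mark i ω := measurable_pi_lambda _ h.measurable_mark
  have hprod := (indepFun_iff_map_prod_eq_prod_map_map hX.aemeasurable hm.aemeasurable).1
    h.indep_locations
  have hF : Measurable fun z : (ℕ → ℂ) × (ℕ → p.Mark) =>
      ∏ i ∈ Finset.range n, v (z.1 i, z.2 i) := by
    refine Finset.measurable_fun_prod _ fun i _ => hv.comp ?_
    exact ((measurable_pi_apply i).comp measurable_fst).prodMk
      ((measurable_pi_apply i).comp measurable_snd)
  have := Measure.isProbabilityMeasure_map (μ := P) hX.aemeasurable
  have := Measure.isProbabilityMeasure_map (μ := P) hm.aemeasurable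
  have e1 : ∫⁻ ω, ∏ i ∈ Finset.range n, v (X i ω, mark i ω) ∂P =
      ∫⁻ z, ∏ i ∈ Finset.range n, v (z.1 i, z.2 i)
        ∂(P.map fun ω => ((fun i => X i ω), fun i => mark i ω)) :=
    (lintegral_map hF (hX.prodMk hm)).symm
  rw [e1, hprod, lintegral_prod _ hF.aemeasurable, lintegral_map hF.lintegral_prod_right' hX]
  refine lintegral_congr fun ω => ?_
  have hFω : Measurable fun y : ℕ → p.Mark => ∏ i ∈ Finset.range n, v (X i ω, y i) :=
    hF.comp measurable_prodMk_left
  rw [lintegral_map hFω hm]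
  have hind := h.indep_marks.comp (fun i a => v (X i ω, a))
    fun i => hv.comp measurable_prodMk_left
  refine (lintegral_prod_eq_prod_lintegral_of_indepFun (Finset.range n) _ hind
    fun i => (hv.comp measurable_prodMk_left).comp (h.measurable_mark i)).trans ?_
  refine Finset.prod_congr rfl fun i _ => ?_
  have hvω : Measurable fun a => v (X i ω, a) := hv.comp measurable_prodMk_left
  rw [← h.law_mark i, lintegral_map hvω (h.measurable_mark i)]
  rfl

/-- The Laplace functional of the marked process: it is again a Poisson process, with intensity
measure `p.intensity`. -/
theorem IsNetwork.lintegral_infProd [IsProbabilityMeasure P] (h : IsNetwork p P X mark)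
    {u : ℂ × p.Mark → ℝ≥0∞} (hu : Measurable u) (h1 : ∀ y, u y ≤ 1)
    (hfin : ∫⁻ y, u y ∂p.intensity ≠ ⊤) :
    ∫⁻ ω, infProd (fun i => 1 - u (X i ω, mark i ω)) ∂P =
      ENNReal.ofReal (Real.exp (-(∫⁻ y, u y ∂p.intensity).toReal)) := by
  have hlam : ENNReal.ofReal p.lam ≠ 0 := (ENNReal.ofReal_pos.2 p.lam_pos).ne'
  have hU : Measurable fun x => ∫⁻ a, u (x, a) ∂p.markLaw := hu.lintegral_prod_right'
  have hU1 : ∀ x, ∫⁻ a, u (x, a) ∂p.markLaw ≤ 1 := fun x =>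
    (lintegral_mono fun a => h1 (x, a)).trans (by simp)
  have hsub : ∀ x, ∫⁻ a, (1 - u (x, a)) ∂p.markLaw = 1 - ∫⁻ a, u (x, a) ∂p.markLaw := by
    intro x
    have hux : Measurable fun a => u (x, a) := hu.comp measurable_prodMk_left
    rw [lintegral_sub hux (ne_top_of_le_ne_top ENNReal.one_ne_top (hU1 x))
      (ae_of_all _ fun a => h1 _)]
    simp
  have hu' : ∀ i, Measurable fun ω => 1 - u (X i ω, mark i ω) := fun i =>
    (hu.comp (h.measurable_pair i)).const_sub 1
  have hU' : ∀ i, Measurable fun ω => 1 - ∫⁻ a, u (X i ω, a) ∂p.markLaw := fun i =>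
    (hU.comp (h.poisson.measurable i)).const_sub 1
  rw [p.lintegral_intensity hu] at hfin ⊢
  have hfin' : ∫⁻ x, ∫⁻ a, u (x, a) ∂p.markLaw ≠ ⊤ := fun h' => hfin (by
    rw [h', ENNReal.mul_top hlam])
  rw [ENNReal.toReal_mul, ENNReal.toReal_ofReal p.lam_pos.le,
    ← h.poisson.lintegral_infProd p.lam_pos.le hU hU1 hfin',
    SmallCell.lintegral_infProd hu' fun _ _ => tsub_le_self,
    SmallCell.lintegral_infProd hU' fun _ _ => tsub_le_self]
  congr 1 with n
  rw [h.lintegral_prod_range (v := fun y => 1 - u y) (hu.const_sub 1)]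
  simp_rw [hsub]

end Network

/-! ### The expected number of points on a void event -/

theorem one_sub_mul_one_sub {W b : ℝ≥0∞} (hW : W ≤ 1) (hb : b ≤ 1) :
    1 - W * (1 - b) = (1 - W) + W * b := by
  lift W to ℝ≥0 using ne_top_of_le_ne_top ENNReal.one_ne_top hW
  lift b to ℝ≥0 using ne_top_of_le_ne_top ENNReal.one_ne_top hb
  norm_cast at hW hb ⊢
  have h1 : W * (1 - b) ≤ 1 := mul_le_one' hW tsub_le_self
  rw [← NNReal.coe_inj, NNReal.coe_sub h1]
  push_cast [NNReal.coe_sub hW, NNReal.coe_sub hb]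
  ring

section DifferenceQuotient

variable {a : ℕ → ℝ≥0∞}

theorem succ_mul_one_sub_prod (ha : ∀ i, a i ≤ 1) (n k : ℕ) :
    ((n : ℝ≥0∞) + 1) * (1 - ∏ i ∈ Finset.range (k + 1), (1 - ((n : ℝ≥0∞) + 1)⁻¹ * a i)) =
      ((n : ℝ≥0∞) + 1) * (1 - ∏ i ∈ Finset.range k, (1 - ((n : ℝ≥0∞) + 1)⁻¹ * a i)) +
        (∏ i ∈ Finset.range k, (1 - ((n : ℝ≥0∞) + 1)⁻¹ * a i)) * a k := by
  have hinv : ((n : ℝ≥0∞) + 1) * ((n : ℝ≥0∞) + 1)⁻¹ = 1 :=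
    ENNReal.mul_inv_cancel (by simp) (by finiteness)
  rw [Finset.prod_range_succ, one_sub_mul_one_sub, mul_add]
  · congr 1
    rw [mul_left_comm, ← mul_assoc ((n : ℝ≥0∞) + 1), hinv, one_mul]
  · exact Finset.prod_le_one' fun i _ => tsub_le_self
  · exact mul_le_one' (ENNReal.inv_le_one.2 le_add_self) (ha k)

/-- The difference quotient at `0`, with increment `ε = 1 / (n + 1)`, of `ε ↦ ∏ i, (1 - ε a i)` is
at most `∑ i, a i` in absolute value. -/
theorem succ_mul_one_sub_infProd_le (ha : ∀ i, a i ≤ 1) (n : ℕ) :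
    ((n : ℝ≥0∞) + 1) * (1 - infProd fun i => 1 - ((n : ℝ≥0∞) + 1)⁻¹ * a i) ≤ ∑' i, a i := by
  rw [infProd, ENNReal.sub_iInf, ENNReal.mul_iSup]
  refine iSup_le fun k => le_trans ?_ (ENNReal.sum_le_tsum (Finset.range k))
  induction k with
  | zero => simp
  | succ k ih =>
    rw [succ_mul_one_sub_prod ha, Finset.sum_range_succ]
    exact add_le_add ih (mul_le_of_le_one_left' (Finset.prod_le_one' fun i _ => tsub_le_self))

/-- The difference quotients in `succ_mul_one_sub_infProd_le` converge to the bound given there,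
whether or not the sum is finite. -/
theorem tsum_le_liminf_succ_mul_one_sub_infProd (ha : ∀ i, a i ≤ 1) :
    ∑' i, a i ≤ liminf (fun n : ℕ =>
      ((n : ℝ≥0∞) + 1) * (1 - infProd fun i => 1 - ((n : ℝ≥0∞) + 1)⁻¹ * a i)) atTop := by
  have hfac : ∀ i, Tendsto (fun n : ℕ => 1 - ((n : ℝ≥0∞) + 1)⁻¹ * a i) atTop (𝓝 1) := by
    intro i
    have h0 : Tendsto (fun n : ℕ => ((n : ℝ≥0∞) + 1)⁻¹) atTop (𝓝 0) := by
      have := (tendsto_add_atTop_iff_nat 1).2 ENNReal.tendsto_inv_nat_nhds_zero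
      exact_mod_cast this
    have h1 := ENNReal.Tendsto.mul_const h0
      (Or.inr (ne_top_of_le_ne_top ENNReal.one_ne_top (ha i)))
    have h2 := ENNReal.Tendsto.sub (tendsto_const_nhds (x := (1 : ℝ≥0∞)) (f := atTop)) h1
      (Or.inl ENNReal.one_ne_top)
    simpa using h2
  have key : ∀ k, Tendsto (fun n : ℕ => ((n : ℝ≥0∞) + 1) *
      (1 - ∏ i ∈ Finset.range k, (1 - ((n : ℝ≥0∞) + 1)⁻¹ * a i))) atTop
      (𝓝 (∑ i ∈ Finset.range k, a i)) := by
    intro k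
    induction k with
    | zero => simp
    | succ k ih =>
      simp_rw [succ_mul_one_sub_prod ha, Finset.sum_range_succ]
      refine ih.add ?_
      have hW := ENNReal.tendsto_finsetProd_of_ne_top (Finset.range k) (fun i _ => hfac i)
        fun i _ => ENNReal.one_ne_top
      simpa using ENNReal.Tendsto.mul_const hW
        (Or.inr (ne_top_of_le_ne_top ENNReal.one_ne_top (ha k)))
  rw [ENNReal.tsum_eq_iSup_nat]
  refine iSup_le fun k => ?_
  rw [← (key k).liminf_eq]
  refine liminf_le_liminf (Eventually.of_forall fun n => ?_)
  gcongr
  exact iInf_le _ k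

end DifferenceQuotient

theorem tendsto_succ_mul_exp_sub_exp (d a : ℝ) :
    Tendsto (fun n : ℕ => ((n : ℝ) + 1) * (Real.exp (-d) - Real.exp (-(d + ((n : ℝ) + 1)⁻¹ * a))))
      atTop (𝓝 (a * Real.exp (-d))) := by
  have hd : HasDerivAt (fun t : ℝ => -Real.exp (-(d + t * a))) (a * Real.exp (-d)) 0 := by
    have h1 : HasDerivAt (fun t : ℝ => -(d + t * a)) (-(1 * a)) 0 :=
      (((hasDerivAt_id (0 : ℝ)).mul_const a).const_add d).neg
    have h2 := h1.exp.neg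
    simp only [zero_mul, add_zero] at h2
    refine h2.congr_deriv ?_
    ring
  have h2 := hasDerivAt_iff_tendsto_slope_zero.1 hd
  have h3 : Tendsto (fun n : ℕ => ((n : ℝ) + 1)⁻¹) atTop (𝓝[≠] 0) := by
    refine tendsto_nhdsWithin_iff.2 ⟨?_, Eventually.of_forall fun n => ?_⟩
    · simpa only [one_div] using tendsto_one_div_add_atTop_nhds_zero_nat (𝕜 := ℝ)
    · exact inv_ne_zero (by positivity)
  refine (h2.comp h3).congr fun n => ?_
  simp only [Function.comp_apply, zero_add, zero_mul, add_zero, inv_inv, smul_eq_mul]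
  ring

section Network

variable {p : Params} {Ω : Type*} [MeasurableSpace Ω] {P : Measure Ω}
  {X : ℕ → Ω → ℂ} {mark : ℕ → Ω → p.Mark}

theorem IsNetwork.measurableSet_void (h : IsNetwork p P X mark) {D : Set (ℂ × p.Mark)}
    (hD : MeasurableSet D) : MeasurableSet {ω | ∀ j, (X j ω, mark j ω) ∉ D} := by
  simp only [ofPred_forall]
  exact MeasurableSet.iInter fun j => (h.measurable_pair j hD).compl

/-- The void probabilities of the marked process. -/
theorem IsNetwork.measure_void [IsProbabilityMeasure P] (h : IsNetwork p P X mark)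
    {D : Set (ℂ × p.Mark)} (hD : MeasurableSet D) (hfin : p.intensity D ≠ ⊤) :
    P {ω | ∀ j, (X j ω, mark j ω) ∉ D} = ENNReal.ofReal (Real.exp (-(p.intensity D).toReal)) := by
  have hint : ∫⁻ y, D.indicator 1 y ∂p.intensity = p.intensity D := lintegral_indicator_one hD
  rw [← hint] at hfin ⊢
  rw [← h.lintegral_infProd (measurable_one.indicator hD)
    (fun y => indicator_le_self' (fun _ _ => zero_le) y) hfin,
    ← lintegral_indicator_one (h.measurableSet_void hD)]
  refine lintegral_congr fun ω => ?_
  by_cases hω : ∀ j, (X j ω, mark j ω) ∉ D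
  · rw [indicator_of_mem (show ω ∈ {ω | ∀ j, (X j ω, mark j ω) ∉ D} from hω), infProd]
    simp [indicator_of_notMem (hω _)]
  · rw [indicator_of_notMem (show ω ∉ {ω | ∀ j, (X j ω, mark j ω) ∉ D} from hω)]
    push Not at hω
    obtain ⟨j, hj⟩ := hω
    refine (le_antisymm ((iInf_le _ (j + 1)).trans (le_of_eq ?_)) zero_le).symm
    exact Finset.prod_eq_zero (Finset.self_mem_range_succ j) (by simp [indicator_of_mem hj])

/-- The expected number of points in `A` on the event that `D` contains no point, for disjoint `A`
and `D`. The Laplace functional at `u = 1_D + ε 1_A` is the expectation of `(1 - ε) ^ N` on this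
event, with `N` the number of points in `A`; subtract it from the void probability, divide by
`ε = 1 / (n + 1)` and let `n → ∞`. -/
theorem IsNetwork.tsum_measure_mem_void [IsProbabilityMeasure P] (h : IsNetwork p P X mark)
    {A D : Set (ℂ × p.Mark)} (hA : MeasurableSet A) (hD : MeasurableSet D) (hAD : Disjoint A D)
    (hAfin : p.intensity A ≠ ⊤) (hDfin : p.intensity D ≠ ⊤) :
    ∑' i, P {ω | (X i ω, mark i ω) ∈ A ∧ ∀ j, (X j ω, mark j ω) ∉ D} =
      p.intensity A * P {ω | ∀ j, (X j ω, mark j ω) ∉ D} := by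
  set V : Set Ω := {ω | ∀ j, (X j ω, mark j ω) ∉ D}
  have hV : MeasurableSet V := h.measurableSet_void hD
  let a : Ω → ℕ → ℝ≥0∞ := fun ω i => A.indicator 1 (X i ω, mark i ω)
  have ha1 : ∀ ω i, a ω i ≤ 1 := fun ω i => indicator_le_self' (fun _ _ => zero_le) _
  have ham : ∀ i, Measurable fun ω => a ω i := fun i =>
    (measurable_one.indicator hA).comp (h.measurable_pair i)
  let w : ℕ → Ω → ℝ≥0∞ := fun n ω => infProd fun i => 1 - ((n : ℝ≥0∞) + 1)⁻¹ * a ω i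
  have hwm : ∀ n, Measurable (w n) := fun n =>
    measurable_infProd fun i => ((ham i).const_mul _).const_sub _
  let g : ℕ → Ω → ℝ≥0∞ := fun n ω => V.indicator (fun ω => ((n : ℝ≥0∞) + 1) * (1 - w n ω)) ω
  have hgm : ∀ n, Measurable (g n) := fun n => (((hwm n).const_sub _).const_mul _).indicator hV
  -- the sum in question, as the expectation of the number of points in `A`
  have hL : ∑' i, P {ω | (X i ω, mark i ω) ∈ A ∧ ∀ j, (X j ω, mark j ω) ∉ D} =
      ∫⁻ ω, V.indicator (fun ω => ∑' i, a ω i) ω ∂P := by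
    have h1 : ∀ ω, V.indicator (fun ω => ∑' i, a ω i) ω = ∑' i, V.indicator (fun ω => a ω i) ω := by
      intro ω
      by_cases hω : ω ∈ V <;> simp [hω]
    simp_rw [h1]
    rw [lintegral_tsum fun i => ((ham i).indicator hV).aemeasurable]
    congr 1 with i
    have hm : MeasurableSet {ω | (X i ω, mark i ω) ∈ A ∧ ∀ j, (X j ω, mark j ω) ∉ D} :=
      ((h.measurable_pair i) hA).inter hV
    rw [← lintegral_indicator_one hm]
    refine lintegral_congr fun ω => ?_
    have hωV : (∀ j, (X j ω, mark j ω) ∉ D) ↔ ω ∈ V := Iff.rfl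
    by_cases hω : ω ∈ V <;> by_cases hi : (X i ω, mark i ω) ∈ A <;>
      simp [-not_forall, a, indicator, hωV, hω, hi]
  have hval : ∀ n : ℕ, ∫⁻ ω, g n ω ∂P = ENNReal.ofReal (((n : ℝ) + 1) *
      (Real.exp (-(p.intensity D).toReal) -
        Real.exp (-((p.intensity D).toReal + ((n : ℝ) + 1)⁻¹ * (p.intensity A).toReal)))) := by
    intro n
    let u : ℂ × p.Mark → ℝ≥0∞ := fun y =>
      D.indicator 1 y + ((n : ℝ≥0∞) + 1)⁻¹ * A.indicator 1 y
    have hinv : ((n : ℝ≥0∞) + 1)⁻¹ ≤ 1 := ENNReal.inv_le_one.2 le_add_self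
    have hum : Measurable u :=
      (measurable_one.indicator hD).add ((measurable_one.indicator hA).const_mul _)
    have hu1 : ∀ y, u y ≤ 1 := by
      intro y
      by_cases hyD : y ∈ D
      · have hyA : y ∉ A := fun hyA => Set.disjoint_left.1 hAD hyA hyD
        simp [u, hyD, hyA]
      · by_cases hyA : y ∈ A
        · simp [u, hyD, hyA]
        · simp [u, hyD, hyA]
    have hui : ∫⁻ y, u y ∂p.intensity =
        p.intensity D + ((n : ℝ≥0∞) + 1)⁻¹ * p.intensity A := by
      rw [lintegral_add_left (measurable_one.indicator hD),
        lintegral_const_mul _ (measurable_one.indicator hA), lintegral_indicator_one hD,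
        lintegral_indicator_one hA]
    have hif : ((n : ℝ≥0∞) + 1)⁻¹ ≠ ⊤ := ne_top_of_le_ne_top ENNReal.one_ne_top hinv
    have hprod := h.lintegral_infProd hum hu1 (by
      rw [hui]
      exact ENNReal.add_ne_top.2 ⟨hDfin, ENNReal.mul_ne_top hif hAfin⟩)
    have hpt : ∀ ω, infProd (fun i => 1 - u (X i ω, mark i ω)) = V.indicator (w n) ω := by
      intro ω
      by_cases hω : ω ∈ V
      · rw [indicator_of_mem hω]
        simp only [w, u, a]
        congr 1 with i
        rw [indicator_of_notMem (hω i), zero_add]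
      · rw [indicator_of_notMem hω]
        simp only [V, mem_ofPred_eq, not_forall, not_not] at hω
        obtain ⟨j, hj⟩ := hω
        refine le_antisymm ((iInf_le _ (j + 1)).trans (le_of_eq ?_)) zero_le
        refine Finset.prod_eq_zero (Finset.self_mem_range_succ j) (tsub_eq_zero_of_le ?_)
        simp [u, indicator_of_mem hj]
    have hg : ∀ ω, g n ω =
        ((n : ℝ≥0∞) + 1) * (V.indicator 1 ω - infProd (fun i => 1 - u (X i ω, mark i ω))) := by
      intro ω
      rw [hpt]
      by_cases hω : ω ∈ V <;> simp [g, hω]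
    have hm : Measurable fun ω => infProd (fun i => 1 - u (X i ω, mark i ω)) :=
      measurable_infProd fun i => (hum.comp (h.measurable_pair i)).const_sub _
    simp_rw [hg]
    have hm' : Measurable fun ω =>
        V.indicator 1 ω - infProd (fun i => 1 - u (X i ω, mark i ω)) :=
      (measurable_one.indicator hV).sub hm
    rw [lintegral_const_mul _ hm', lintegral_sub hm, lintegral_indicator_one hV, hprod,
      h.measure_void hD hDfin, hui,
      ENNReal.toReal_add hDfin (ENNReal.mul_ne_top hif hAfin), ENNReal.toReal_mul,
      ENNReal.toReal_inv, ENNReal.ofReal_mul (by positivity),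
      ENNReal.ofReal_sub _ (Real.exp_pos _).le]
    · congr 1
      rw [ENNReal.ofReal_add (by positivity) one_pos.le]
      simp
    · rw [hprod]
      exact ENNReal.ofReal_ne_top
    · refine ae_of_all _ fun ω => ?_
      simp only [hpt]
      exact indicator_le_indicator (infProd_le_one _)
  have hlim : Tendsto (fun n => ∫⁻ ω, g n ω ∂P) atTop
      (𝓝 (p.intensity A * P V)) := by
    rw [h.measure_void hD hDfin, ← ENNReal.ofReal_toReal hAfin,
      ← ENNReal.ofReal_mul ENNReal.toReal_nonneg]
    simp_rw [hval]
    exact ENNReal.tendsto_ofReal (tendsto_succ_mul_exp_sub_exp _ _)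
  rw [hL]
  apply le_antisymm
  · rw [← hlim.liminf_eq]
    refine le_trans (lintegral_mono fun ω => ?_) (lintegral_liminf_le hgm)
    by_cases hω : ω ∈ V
    · simp only [g, indicator_of_mem hω]
      exact tsum_le_liminf_succ_mul_one_sub_infProd (ha1 ω)
    · simp [indicator_of_notMem hω]
  · refine le_of_tendsto' hlim fun n => lintegral_mono fun ω => ?_
    exact indicator_le_indicator (succ_mul_one_sub_infProd_le (ha1 ω) n)

end Network

/-! ### Points of maximal score -/

/-- The least multiple of `2⁻ⁿ` that is at least `t`, for `t ≥ 0`. -/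
def dyadicCeil (n : ℕ) (t : ℝ) : ℝ := ⌈2 ^ n * t⌉₊ / 2 ^ n

theorem le_dyadicCeil (n : ℕ) (t : ℝ) : t ≤ dyadicCeil n t := by
  rw [dyadicCeil, le_div_iff₀ (by positivity), mul_comm]
  exact Nat.le_ceil _

theorem antitone_dyadicCeil (t : ℝ) : Antitone fun n => dyadicCeil n t := by
  refine antitone_nat_of_succ_le fun n => ?_
  simp only [dyadicCeil]
  rw [div_le_div_iff₀ (by positivity) (by positivity), pow_succ]
  have h : ⌈2 ^ n * 2 * t⌉₊ ≤ ⌈2 ^ n * t⌉₊ * 2 := by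
    refine Nat.ceil_le.2 ?_
    push_cast
    nlinarith [Nat.le_ceil (2 ^ n * t)]
  have h' : (⌈2 ^ n * 2 * t⌉₊ : ℝ) ≤ ⌈2 ^ n * t⌉₊ * 2 := by exact_mod_cast h
  calc (⌈2 ^ n * 2 * t⌉₊ : ℝ) * 2 ^ n ≤ ⌈2 ^ n * t⌉₊ * 2 * 2 ^ n := by gcongr
    _ = _ := by ring

theorem forall_le_dyadicCeil_iff {s t : ℝ} (ht : 0 ≤ t) :
    (∀ n, s ≤ dyadicCeil n t) ↔ s ≤ t := by
  refine ⟨fun h => ?_, fun h n => h.trans (le_dyadicCeil n t)⟩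
  have h0 : Tendsto (fun n : ℕ => t + (1 / 2 : ℝ) ^ n) atTop (𝓝 (t + 0)) :=
    (tendsto_pow_atTop_nhds_zero_of_lt_one (by norm_num) (by norm_num)).const_add t
  rw [add_zero] at h0
  refine ge_of_tendsto' h0 fun n => (h n).trans ?_
  rw [dyadicCeil, div_le_iff₀ (by positivity), add_mul, ← mul_pow]
  have := (Nat.ceil_lt_add_one (a := 2 ^ n * t) (by positivity)).le
  norm_num
  linarith

theorem measurable_natCeil_dyadic (n : ℕ) : Measurable fun t : ℝ => ⌈2 ^ n * t⌉₊ :=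
  Nat.measurable_ceil.comp (measurable_id.const_mul _)

section Network

variable {p : Params} {Ω : Type*} [MeasurableSpace Ω] {P : Measure Ω}
  {X : ℕ → Ω → ℂ} {mark : ℕ → Ω → p.Mark} {T : ℂ × p.Mark → ℝ}

theorem IsNetwork.measurableSet_forall_le (h : IsNetwork p P X mark) (hT : Measurable T) {s : Ω → ℝ}
    (hs : Measurable s) : MeasurableSet {ω | ∀ j, T (X j ω, mark j ω) ≤ s ω} := by
  simp only [ofPred_forall]
  exact MeasurableSet.iInter fun j => measurableSet_le (hT.comp (h.measurable_pair j)) hs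

theorem monotone_measure_forall_le (P : Measure Ω) (X : ℕ → Ω → ℂ) (mark : ℕ → Ω → p.Mark)
    (T : ℂ × p.Mark → ℝ) : Monotone fun t => P {ω | ∀ j, T (X j ω, mark j ω) ≤ t} :=
  fun _ _ hst => measure_mono fun _ hω j => (hω j).trans hst

/-- The Mecke formula for points that are maximal up to the rounding `dyadicCeil n`. The points are
split according to their rounded scores. -/
theorem IsNetwork.tsum_measure_mem_le_dyadicCeil [IsProbabilityMeasure P]
    (h : IsNetwork p P X mark) (hT : Measurable T)
    (hfin : ∀ t, 0 < t → p.intensity {y | t < T y} ≠ ⊤) {A : Set (ℂ × p.Mark)}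
    (hA : MeasurableSet A) (hAfin : p.intensity A ≠ ⊤) (hpos : ∀ y ∈ A, 0 < T y) (n : ℕ) :
    ∑' i, P {ω | (X i ω, mark i ω) ∈ A ∧
        ∀ j, T (X j ω, mark j ω) ≤ dyadicCeil n (T (X i ω, mark i ω))} =
      ∫⁻ y in A, P {ω | ∀ j, T (X j ω, mark j ω) ≤ dyadicCeil n (T y)} ∂p.intensity := by
  let κ : ℂ × p.Mark → ℕ := fun y => ⌈2 ^ n * T y⌉₊
  have hκ : Measurable κ := (measurable_natCeil_dyadic n).comp hT
  let t : ℕ → ℝ := fun k => k / 2 ^ n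
  have hκt : ∀ y, dyadicCeil n (T y) = t (κ y) := fun y => rfl
  let B : ℕ → Set (ℂ × p.Mark) := fun k => A ∩ κ ⁻¹' {k}
  have hB : ∀ k, MeasurableSet (B k) := fun k => hA.inter (hκ (measurableSet_singleton k))
  have hBd : Pairwise (Function.onFun Disjoint B) := fun k l hkl =>
    Set.disjoint_left.2 fun y hy hy' => hkl (hy.2.symm.trans hy'.2)
  have hBU : A = ⋃ k, B k := by
    rw [← inter_iUnion, ← preimage_iUnion, iUnion_of_singleton, preimage_univ, inter_univ]
  have hterm : ∀ k, ∑' i, P {ω | (X i ω, mark i ω) ∈ B k ∧ ∀ j, T (X j ω, mark j ω) ≤ t k} =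
      p.intensity (B k) * P {ω | ∀ j, T (X j ω, mark j ω) ≤ t k} := by
    intro k
    rcases Nat.eq_zero_or_pos k with rfl | hk
    · have hB0 : B 0 = ∅ := by
        refine eq_empty_of_forall_notMem fun y hy => ?_
        have h1 : ⌈2 ^ n * T y⌉₊ = 0 := hy.2
        have h2 := Nat.ceil_eq_zero.1 h1
        have h3 := hpos y hy.1
        have : 0 < 2 ^ n * T y := by positivity
        linarith
      simp [hB0]
    · have htk : 0 < t k := by
        have : (0 : ℝ) < k := by exact_mod_cast hk
        positivity
      have := h.tsum_measure_mem_void (hB k) (measurableSet_lt measurable_const hT)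
        (Set.disjoint_left.2 fun y hy hy' => ?_)
        (ne_top_of_le_ne_top hAfin (measure_mono inter_subset_left)) (hfin _ htk)
      · simpa only [mem_ofPred_eq, not_lt] using this
      · have h1 := le_dyadicCeil n (T y)
        rw [hκt, show κ y = k from hy.2] at h1
        exact (not_lt.2 h1) hy'
  have hL : ∀ i, P {ω | (X i ω, mark i ω) ∈ A ∧
        ∀ j, T (X j ω, mark j ω) ≤ dyadicCeil n (T (X i ω, mark i ω))} =
      ∑' k, P {ω | (X i ω, mark i ω) ∈ B k ∧ ∀ j, T (X j ω, mark j ω) ≤ t k} := by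
    intro i
    rw [← measure_iUnion]
    · congr 1
      ext ω
      simp only [mem_iUnion, mem_ofPred_eq, B, mem_inter_iff, mem_preimage, mem_singleton_iff, hκt]
      constructor
      · exact fun hω => ⟨_, ⟨hω.1, rfl⟩, hω.2⟩
      · rintro ⟨k, ⟨h1, rfl⟩, h2⟩
        exact ⟨h1, h2⟩
    · exact fun k l hkl => Set.disjoint_left.2 fun ω hω hω' =>
        Set.disjoint_left.1 (hBd hkl) hω.1 hω'.1
    · exact fun k => (h.measurable_pair i (hB k)).inter
        (h.measurableSet_forall_le hT measurable_const)
  simp_rw [hL]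
  rw [ENNReal.tsum_comm]
  simp_rw [hterm]
  rw [hBU, lintegral_iUnion hB hBd]
  congr 1 with k
  rw [setLIntegral_congr_fun (g := fun _ => P {ω | ∀ j, T (X j ω, mark j ω) ≤ t k}) (hB k)
    (fun y hy => ?_), setLIntegral_const, mul_comm]
  simp only [hκt]
  rw [show κ y = k from hy.2]

theorem IsNetwork.tsum_measure_mem_max_of_ne_top [IsProbabilityMeasure P]
    (h : IsNetwork p P X mark) (hT : Measurable T)
    (hfin : ∀ t, 0 < t → p.intensity {y | t < T y} ≠ ⊤) {A : Set (ℂ × p.Mark)}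
    (hA : MeasurableSet A) (hAfin : p.intensity A ≠ ⊤) (hpos : ∀ y ∈ A, 0 < T y) :
    ∑' i, P {ω | (X i ω, mark i ω) ∈ A ∧
        ∀ j, T (X j ω, mark j ω) ≤ T (X i ω, mark i ω)} =
      ∫⁻ y in A, P {ω | ∀ j, T (X j ω, mark j ω) ≤ T y} ∂p.intensity := by
  let F : ℝ → ℝ≥0∞ := fun t => P {ω | ∀ j, T (X j ω, mark j ω) ≤ t}
  have hFm : Monotone F := monotone_measure_forall_le P X mark T
  have hceil : ∀ n, Measurable fun y : ℂ × p.Mark => dyadicCeil n (T y) := fun n =>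
    (measurable_from_nat.comp ((measurable_natCeil_dyadic n).comp hT)).div_const _
  have hFn : ∀ n, Measurable fun y => F (dyadicCeil n (T y)) := fun n =>
    hFm.measurable.comp (hceil n)
  have hF1 : ∀ t, F t ≤ 1 := fun t => prob_le_one
  have hF : ∀ y ∈ A, F (T y) = ⨅ n, F (dyadicCeil n (T y)) := by
    intro y hy
    simp only [F]
    rw [← Antitone.measure_iInter]
    · congr 1
      ext ω
      simp only [mem_ofPred_eq, mem_iInter]
      rw [forall_comm]
      simp_rw [forall_le_dyadicCeil_iff (hpos y hy).le]
    · exact fun m n hmn ω hω j => (hω j).trans (antitone_dyadicCeil _ hmn)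
    · exact fun n => (h.measurableSet_forall_le hT measurable_const).nullMeasurableSet
    · exact ⟨0, measure_ne_top _ _⟩
  let S : ℕ → ℕ → Set Ω := fun n i => {ω | (X i ω, mark i ω) ∈ A ∧
        ∀ j, T (X j ω, mark j ω) ≤ dyadicCeil n (T (X i ω, mark i ω))}
  have hSanti : ∀ i, Antitone fun n => S n i := fun i m n hmn ω hω =>
    ⟨hω.1, fun j => (hω.2 j).trans (antitone_dyadicCeil _ hmn)⟩
  have hSm : ∀ n i, MeasurableSet (S n i) := fun n i => (h.measurable_pair i hA).inter
    (h.measurableSet_forall_le hT ((hceil n).comp (h.measurable_pair i)))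
  have hS : ∀ i, P {ω | (X i ω, mark i ω) ∈ A ∧
      ∀ j, T (X j ω, mark j ω) ≤ T (X i ω, mark i ω)} = ⨅ n, P (S n i) := by
    intro i
    rw [← (hSanti i).measure_iInter (fun n => (hSm n i).nullMeasurableSet)
      ⟨0, measure_ne_top _ _⟩]
    congr 1
    ext ω
    simp only [S, mem_ofPred_eq, mem_iInter, forall_and, forall_const]
    refine and_congr_right fun hω => ?_
    rw [forall_comm]
    simp_rw [forall_le_dyadicCeil_iff (hpos _ hω).le]
  have hn : ∀ n, ∑' i, P (S n i) = ∫⁻ y in A, F (dyadicCeil n (T y)) ∂p.intensity :=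
    h.tsum_measure_mem_le_dyadicCeil hT hfin hA hAfin hpos
  have hle : ∀ n, ∫⁻ y in A, F (dyadicCeil n (T y)) ∂p.intensity ≠ ⊤ := fun n =>
    ne_top_of_le_ne_top hAfin ((lintegral_mono fun y => hF1 _).trans (by simp))
  simp_rw [hS]
  rw [← lintegral_count, lintegral_iInf (fun n => measurable_from_nat)
    (fun m n hmn i => measure_mono (hSanti i hmn)), setLIntegral_congr_fun hA hF,
    lintegral_iInf hFn (fun m n hmn y => hFm (antitone_dyadicCeil _ hmn)) (hle 0)]
  · simp_rw [lintegral_count, hn]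
  · rw [lintegral_count, hn]
    exact hle 0

/-- The Mecke formula for the points of maximal score: the expected number of points in `A` whose
score is the maximum is the integral over `A` of the probability that no point of the process
exceeds the score of an added point. -/
theorem IsNetwork.tsum_measure_mem_max [IsProbabilityMeasure P]
    (h : IsNetwork p P X mark) (hT : Measurable T)
    (hfin : ∀ t, 0 < t → p.intensity {y | t < T y} ≠ ⊤) {A : Set (ℂ × p.Mark)}
    (hA : MeasurableSet A) (hnull : p.intensity (A ∩ {y | T y ≤ 0}) = 0) :
    ∑' i, P {ω | (X i ω, mark i ω) ∈ A ∧
        ∀ j, T (X j ω, mark j ω) ≤ T (X i ω, mark i ω)} =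
      ∫⁻ y in A, P {ω | ∀ j, T (X j ω, mark j ω) ≤ T y} ∂p.intensity := by
  let N : Set (ℂ × p.Mark) := A ∩ {y | T y ≤ 0}
  have hN : MeasurableSet N := hA.inter (measurableSet_le hT measurable_const)
  have hPN : ∀ i, P {ω | (X i ω, mark i ω) ∈ N} = 0 := by
    have := h.tsum_measure_mem_void hN MeasurableSet.empty (disjoint_empty N)
      (hnull.trans_ne ENNReal.zero_ne_top) (by simp)
    rw [hnull, zero_mul, ENNReal.tsum_eq_zero] at this
    simpa using this
  let B : ℕ → Set (ℂ × p.Mark) := fun k => (A \ N) ∩ disjointed (spanningSets p.intensity) k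
  have hB : ∀ k, MeasurableSet (B k) := fun k =>
    (hA.diff hN).inter (MeasurableSet.disjointed (measurableSet_spanningSets _) k)
  have hBd : Pairwise (Function.onFun Disjoint B) := fun k l hkl =>
    (disjoint_disjointed _ hkl).mono inter_subset_right inter_subset_right
  have hBU : ⋃ k, B k = A \ N := by
    rw [← inter_iUnion, iUnion_disjointed, iUnion_spanningSets, inter_univ]
  have hBfin : ∀ k, p.intensity (B k) ≠ ⊤ := fun k =>
    ne_top_of_le_ne_top (measure_spanningSets_lt_top p.intensity k).ne
      (measure_mono (inter_subset_right.trans (disjointed_subset _ k)))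
  have hBpos : ∀ k, ∀ y ∈ B k, 0 < T y := fun k y hy =>
    not_le.1 fun h0 => hy.1.2 ⟨hy.1.1, h0⟩
  have hAN : (A \ N : Set _) =ᵐ[p.intensity] A := sdiff_null_ae_eq_self hnull
  rw [← setLIntegral_congr hAN, ← hBU, lintegral_iUnion hB hBd]
  simp_rw [← fun k => h.tsum_measure_mem_max_of_ne_top hT hfin (hB k) (hBfin k) (hBpos k)]
  rw [ENNReal.tsum_comm]
  congr 1 with i
  rw [← measure_iUnion]
  · refine measure_congr ?_
    filter_upwards [measure_eq_zero_iff_ae_notMem.1 (hPN i)] with ω hω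
    refine propext ?_
    have hmem : (X i ω, mark i ω) ∈ A ↔ ∃ k, (X i ω, mark i ω) ∈ B k := by
      rw [← mem_iUnion, hBU]
      exact ⟨fun h1 => ⟨h1, hω⟩, fun h1 => h1.1⟩
    change ((X i ω, mark i ω) ∈ A ∧ _) ↔ ω ∈ ⋃ k, {ω | (X i ω, mark i ω) ∈ B k ∧
      ∀ j, T (X j ω, mark j ω) ≤ T (X i ω, mark i ω)}
    rw [hmem, mem_iUnion]
    exact exists_and_right.symm
  · exact fun k l hkl => Set.disjoint_left.2 fun ω hω hω' =>
      Set.disjoint_left.1 (hBd hkl) hω.1 hω'.1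
  · exact fun k => (h.measurable_pair i (hB k)).inter
      (h.measurableSet_forall_le hT (hT.comp (h.measurable_pair i)))

end Network

/-! ### The received power -/

theorem measurable_userAngle : Measurable userAngle := by
  have h : Measurable polarAngle :=
    Measurable.ite (measurableSet_le measurable_const Complex.measurable_arg)
      Complex.measurable_arg (Complex.measurable_arg.add_const _)
  exact Measurable.ite (measurableSet_lt h measurable_const) (h.add_const _) (h.sub_const _)

namespace Params

variable (p : Params)

theorem measurable_sectionOf : Measurable p.sectionOf := by
  have h : Measurable fun x : ℂ => ⌊(p.M : ℝ) * userAngle x / (2 * Real.pi)⌋₊ :=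
    Nat.measurable_floor.comp ((measurable_userAngle.const_mul _).div_const _)
  refine measurable_to_countable' fun m => ?_
  have : p.sectionOf ⁻¹' {m} =
      (fun x : ℂ => ⌊(p.M : ℝ) * userAngle x / (2 * Real.pi)⌋₊) ⁻¹' {m.1} := by
    ext x
    simp [sectionOf, Fin.ext_iff]
  rw [this]
  exact h (measurableSet_singleton _)

theorem measurable_power : Measurable fun y : ℂ × p.Mark => p.power y.1 y.2 := by
  have hs : Measurable fun y : ℂ × p.Mark => y.2.2.2 (p.sectionOf y.1) := by
    have h1 : Measurable fun z : (Fin p.M → ℝ) × Fin p.M => z.1 z.2 :=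
      measurable_from_prod_countable_left fun m => measurable_pi_apply m
    exact h1.comp ((measurable_snd.comp (measurable_snd.comp measurable_snd)).prodMk
      (p.measurable_sectionOf.comp measurable_fst))
  unfold power
  fun_prop

/-! ### Integration against the law of a mark -/

theorem lintegral_expMeasure_one {f : ℝ → ℝ≥0∞} (hf : Measurable f) :
    ∫⁻ h, f h ∂(expMeasure 1) = ∫⁻ h in Ioi (0 : ℝ), ENNReal.ofReal (Real.exp (-h)) * f h := by
  have hpdf : Measurable (gammaPDF 1 1) := (measurable_gammaPDFReal 1 1).ennreal_ofReal
  rw [expMeasure, gammaMeasure, lintegral_withDensity_eq_lintegral_mul _ hpdf hf,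
    ← lintegral_indicator measurableSet_Ioi]
  refine lintegral_congr_ae ?_
  filter_upwards [Measure.ae_ne volume (0 : ℝ)] with h h0
  rcases lt_or_gt_of_ne h0 with hneg | hpos
  · simp [indicator, gammaPDF, gammaPDFReal, not_le.2 hneg, not_lt.2 hneg.le]
  · simp [indicator, gammaPDF, gammaPDFReal, hpos, hpos.le]

theorem lintegral_exponentLaw {f : ℝ → ℝ≥0∞} :
    ∫⁻ β, f β ∂p.exponentLaw =
      ENNReal.ofReal (1 / (2 * √3 * p.sd)) * ∫⁻ β in Ioc p.lo p.hi, f β := by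
  rw [exponentLaw, ProbabilityTheory.cond, lintegral_smul_measure, Real.volume_Icc, smul_eq_mul,
    p.hi_sub_lo, ← ENNReal.ofReal_inv_of_pos (p.hi_sub_lo ▸ p.hi_sub_lo_pos), one_div,
    restrict_Ioc_eq_restrict_Icc]

/-- Only the exponent of one section enters, and the gain, the fading and this exponent are
independent. -/
theorem lintegral_markLaw (m : Fin p.M) {f : ℝ × ℝ × ℝ → ℝ≥0∞} (hf : Measurable f) :
    ∫⁻ a, f (a.1, a.2.1, a.2.2 m) ∂p.markLaw =
      ∑ n, ENNReal.ofReal (p.gainProb n) *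
        ∫⁻ h, ∫⁻ β, f (p.gain n, h, β) ∂p.exponentLaw ∂(expMeasure 1) := by
  have := isProbabilityMeasure_expMeasure one_pos
  have hmp : MeasurePreserving (fun a : p.Mark => (a.1, a.2.1, a.2.2 m)) p.markLaw
      (p.gainLaw.prod ((expMeasure 1).prod p.exponentLaw)) :=
    (MeasurePreserving.id _).prod ((MeasurePreserving.id _).prod
      (measurePreserving_eval (fun _ : Fin p.M => p.exponentLaw) m))
  rw [hmp.lintegral_comp hf, lintegral_prod _ hf.aemeasurable, lintegral_gainLaw]
  refine Finset.sum_congr rfl fun n _ => ?_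
  have hfn : Measurable fun z : ℝ × ℝ => f (p.gain n, z) := hf.comp measurable_prodMk_left
  rw [lintegral_prod _ hfn.aemeasurable]

theorem ae_power_pos {x : ℂ} (hx : x ≠ 0) : ∀ᵐ a ∂p.markLaw, 0 < p.power x a := by
  have hs : MeasurableSet {z : ℝ × ℝ × ℝ | z.1 * z.2.1 ≤ 0} := by
    refine measurableSet_le ?_ measurable_const
    fun_prop
  have h0 := p.lintegral_markLaw (p.sectionOf x) (f := indicator {z | z.1 * z.2.1 ≤ 0} 1)
    (measurable_one.indicator hs)
  have h1 : ∀ n, ∫⁻ h, ∫⁻ β, indicator {z : ℝ × ℝ × ℝ | z.1 * z.2.1 ≤ 0} 1 (p.gain n, h, β)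
      ∂p.exponentLaw ∂(expMeasure 1) = 0 := by
    intro n
    have hm : Measurable fun h : ℝ => indicator {h : ℝ | p.gain n * h ≤ 0} (1 : ℝ → ℝ≥0∞) h := by
      refine measurable_one.indicator (measurableSet_le ?_ measurable_const)
      fun_prop
    have h2 : ∀ h : ℝ, ∫⁻ β, indicator {z : ℝ × ℝ × ℝ | z.1 * z.2.1 ≤ 0} 1 (p.gain n, h, β)
        ∂p.exponentLaw = indicator {h : ℝ | p.gain n * h ≤ 0} (1 : ℝ → ℝ≥0∞) h := by
      intro h
      simp only [indicator, mem_ofPred_eq, Pi.one_apply, lintegral_const, measure_univ, mul_one]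
    simp_rw [h2]
    rw [lintegral_expMeasure_one hm, setLIntegral_congr_fun (g := fun _ => 0) measurableSet_Ioi,
      lintegral_zero]
    intro h hh
    have : 0 < p.gain n * h := mul_pos (p.gain_pos n) hh
    simp [not_le.2 this]
  simp_rw [h1, mul_zero, Finset.sum_const_zero] at h0
  have hm : Measurable fun a : p.Mark => indicator {z : ℝ × ℝ × ℝ | z.1 * z.2.1 ≤ 0}
      (1 : ℝ × ℝ × ℝ → ℝ≥0∞) (a.1, a.2.1, a.2.2 (p.sectionOf x)) :=
    (measurable_one.indicator hs).comp (by fun_prop)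
  rw [lintegral_eq_zero_iff hm] at h0
  filter_upwards [h0] with a ha
  have hpos : 0 < a.1 * a.2.1 := by
    by_contra hc
    simp [not_lt.1 hc] at ha
  unfold power
  rw [mul_assoc p.PT]
  have := p.PT_pos
  have := norm_pos_iff.2 hx
  positivity

end Params

/-! ### The intensity of the stations above a power level -/

theorem lintegral_exp_neg_mul_rpow {s : ℝ} (hs : -1 < s) :
    ∫⁻ h in Ioi (0 : ℝ), ENNReal.ofReal (Real.exp (-h) * h ^ s) =
      ENNReal.ofReal (Real.Gamma (s + 1)) := by
  have h0 : 0 < s + 1 := by linarith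
  have hint := Real.GammaIntegral_convergent h0
  rw [Real.Gamma_eq_integral h0]
  simp only [add_sub_cancel_right] at hint ⊢
  rw [ofReal_integral_eq_lintegral_ofReal hint]
  exact (ae_restrict_iff' measurableSet_Ioi).2 (ae_of_all _ fun h hh =>
    mul_nonneg (Real.exp_pos _).le (Real.rpow_nonneg (le_of_lt hh) _))

/-- Up to the null set `{0}`, the points from which the power exceeds `t` form a disc. -/
theorem volume_lt_mul_norm_rpow {t c β : ℝ} (ht : 0 < t) (hc : 0 < c) (hβ : 0 < β) :
    volume {x : ℂ | t < c * ‖x‖ ^ (-β)} =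
      ENNReal.ofReal (Real.pi * (c / t) ^ (2 / β)) := by
  have hct : 0 < c / t := div_pos hc ht
  have hae : {x : ℂ | t < c * ‖x‖ ^ (-β)} =ᵐ[volume] Metric.ball 0 ((c / t) ^ (1 / β)) := by
    filter_upwards [Measure.ae_ne volume (0 : ℂ)] with x hx
    refine propext ?_
    have hn : 0 < ‖x‖ := norm_pos_iff.2 hx
    change t < c * ‖x‖ ^ (-β) ↔ x ∈ Metric.ball 0 ((c / t) ^ (1 / β))
    rw [mem_ball_zero_iff, Real.rpow_neg hn.le, one_div,
      Real.lt_rpow_inv_iff_of_pos hn.le hct.le hβ,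
      lt_div_iff₀ ht, ← div_eq_mul_inv, lt_div_iff₀ (Real.rpow_pos_of_pos hn _), mul_comm]
  rw [measure_congr hae, Complex.volume_ball, ← ENNReal.ofReal_pow (by positivity),
    ← Real.rpow_natCast, ← Real.rpow_mul hct.le, mul_comm,
    ENNReal.ofReal_mul Real.pi_pos.le, ← NNReal.coe_real_pi, ENNReal.ofReal_coe_nnreal]
  congr 3
  push_cast
  ring

theorem lintegral_exp_neg_mul_disc {c s : ℝ} (hc : 0 < c) (hs : 0 < s) :
    ∫⁻ h in Ioi (0 : ℝ), ENNReal.ofReal (Real.exp (-h)) *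
        ENNReal.ofReal (Real.pi * (c * h) ^ s) =
      ENNReal.ofReal (Real.pi * (c⁻¹ ^ (-s) * (s * Real.Gamma s))) := by
  have h1 : ∀ h ∈ Ioi (0 : ℝ), ENNReal.ofReal (Real.exp (-h)) *
      ENNReal.ofReal (Real.pi * (c * h) ^ s) =
      ENNReal.ofReal (Real.pi * c ^ s) * ENNReal.ofReal (Real.exp (-h) * h ^ s) := by
    intro h hh
    rw [← ENNReal.ofReal_mul (Real.exp_pos _).le, ← ENNReal.ofReal_mul (by positivity),
      Real.mul_rpow hc.le (le_of_lt hh)]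
    congr 1
    ring
  rw [setLIntegral_congr_fun measurableSet_Ioi h1, lintegral_const_mul' _ _ ENNReal.ofReal_ne_top,
    lintegral_exp_neg_mul_rpow (by linarith), ← ENNReal.ofReal_mul (by positivity),
    Real.Gamma_add_one hs.ne', Real.inv_rpow hc.le, Real.rpow_neg hc.le, inv_inv, mul_assoc]

namespace Params

variable (p : Params)

/-- The expected number of stations from which a power above `t` is received. -/
def meanAbove (t : ℝ) : ℝ :=
  p.lam * Real.pi / (√3 * p.sd) * ∑ n, p.gainProb n *
    ∫ β in p.lo..p.hi, (t / (p.PT * p.gain n)) ^ (-(2 / β)) * Real.Gamma (2 / β) / β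

theorem continuousOn_rpow_mul_Gamma {u : ℝ} (hu : 0 < u) :
    ContinuousOn (fun β : ℝ => u ^ (-(2 / β)) * Real.Gamma (2 / β) / β) (Icc p.lo p.hi) := by
  have hpos : ∀ β ∈ Icc p.lo p.hi, 0 < β := fun β hβ => p.lo_pos.trans_le hβ.1
  have hdiv : ContinuousOn (fun β : ℝ => 2 / β) (Icc p.lo p.hi) :=
    continuousOn_const.div continuousOn_id fun β hβ => (hpos β hβ).ne'
  have hΓ : ContinuousOn (fun β : ℝ => Real.Gamma (2 / β)) (Icc p.lo p.hi) := by
    intro β hβ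
    have h0 : 0 < 2 / β := div_pos two_pos (hpos β hβ)
    have hd : ContinuousAt Real.Gamma (2 / β) :=
      (Real.differentiableAt_Gamma fun m => by
        have : (0 : ℝ) ≤ m := m.cast_nonneg
        linarith).continuousAt
    exact hd.comp_continuousWithinAt (f := fun β : ℝ => 2 / β) (hdiv β hβ)
  exact ((continuousOn_const.rpow hdiv.neg fun _ _ => Or.inl hu.ne').mul hΓ).div
    continuousOn_id fun β hβ => (hpos β hβ).ne'

theorem rpow_mul_Gamma_nonneg {u β : ℝ} (hu : 0 < u) (hβ : β ∈ Icc p.lo p.hi) :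
    0 ≤ u ^ (-(2 / β)) * Real.Gamma (2 / β) / β := by
  have hβ0 : 0 < β := p.lo_pos.trans_le hβ.1
  have := Real.Gamma_pos_of_pos (div_pos two_pos hβ0)
  positivity

theorem intensity_lt_power {t : ℝ} (ht : 0 < t) :
    p.intensity {y | t < p.power y.1 y.2} = ENNReal.ofReal (p.meanAbove t) := by
  have := isProbabilityMeasure_expMeasure one_pos
  have hlohi : p.lo ≤ p.hi := (sub_pos.1 p.hi_sub_lo_pos).le
  have hmeas : MeasurableSet {y : ℂ × p.Mark | t < p.power y.1 y.2} :=
    measurableSet_lt measurable_const p.measurable_power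
  -- the event as a function of location, gain, fading and the relevant exponent
  let E : ℂ × ℝ × ℝ × ℝ → ℝ≥0∞ :=
    indicator {z | t < p.PT * z.2.1 * z.2.2.1 * ‖z.1‖ ^ (-z.2.2.2)} 1
  have hE : Measurable E := by
    refine measurable_one.indicator (measurableSet_lt measurable_const ?_)
    fun_prop
  have hEn : ∀ n, Measurable fun z : ℂ × ℝ × ℝ => E (z.1, p.gain n, z.2) := fun n =>
    hE.comp (by fun_prop)
  have hvol : ∀ n h β, 0 < h → 0 < β → ∫⁻ x, E (x, p.gain n, h, β) =
      ENNReal.ofReal (Real.pi * (((t / (p.PT * p.gain n))⁻¹) * h) ^ (2 / β)) := by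
    intro n h β hh hβ
    have hc : 0 < p.PT * p.gain n * h := mul_pos (mul_pos p.PT_pos (p.gain_pos n)) hh
    have hm : MeasurableSet {x : ℂ | t < p.PT * p.gain n * h * ‖x‖ ^ (-β)} := by
      refine measurableSet_lt measurable_const ?_
      fun_prop
    have h2 : t / (p.PT * p.gain n) ≠ 0 :=
      (div_pos ht (mul_pos p.PT_pos (p.gain_pos n))).ne'
    calc ∫⁻ x, E (x, p.gain n, h, β)
        = ∫⁻ x, indicator {x : ℂ | t < p.PT * p.gain n * h * ‖x‖ ^ (-β)} 1 x := rfl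
      _ = ENNReal.ofReal (Real.pi * (p.PT * p.gain n * h / t) ^ (2 / β)) := by
        rw [lintegral_indicator_one hm, volume_lt_mul_norm_rpow ht hc hβ]
      _ = _ := by
        rw [inv_div, div_mul_eq_mul_div]
  have hn : ∀ n, ∫⁻ x, ∫⁻ h, ∫⁻ β, E (x, p.gain n, h, β) ∂p.exponentLaw ∂(expMeasure 1) =
      ENNReal.ofReal (1 / (2 * √3 * p.sd) * (2 * Real.pi * ∫ β in p.lo..p.hi,
        (t / (p.PT * p.gain n)) ^ (-(2 / β)) * Real.Gamma (2 / β) / β)) := by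
    intro n
    have hu : 0 < t / (p.PT * p.gain n) := div_pos ht (mul_pos p.PT_pos (p.gain_pos n))
    have hswap : ∫⁻ x, ∫⁻ h, ∫⁻ β, E (x, p.gain n, h, β) ∂p.exponentLaw ∂(expMeasure 1) =
        ∫⁻ β, ∫⁻ h, (∫⁻ x, E (x, p.gain n, h, β)) ∂(expMeasure 1) ∂p.exponentLaw := by
      have e1 : ∀ x, ∫⁻ h, ∫⁻ β, E (x, p.gain n, h, β) ∂p.exponentLaw ∂(expMeasure 1) =
          ∫⁻ z, E (x, p.gain n, z) ∂((expMeasure 1).prod p.exponentLaw) := fun x =>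
        (lintegral_prod (fun z : ℝ × ℝ => E (x, p.gain n, z))
          (hE.comp (by fun_prop)).aemeasurable).symm
      simp_rw [e1]
      rw [lintegral_lintegral_swap (hEn n).aemeasurable,
        lintegral_prod_symm _ (hEn n).lintegral_prod_left'.aemeasurable]
    have hβ : ∀ β ∈ Ioc p.lo p.hi, ∫⁻ h, (∫⁻ x, E (x, p.gain n, h, β)) ∂(expMeasure 1) =
        ENNReal.ofReal (2 * Real.pi *
          ((t / (p.PT * p.gain n)) ^ (-(2 / β)) * Real.Gamma (2 / β) / β)) := by
      intro β hβ
      have hβ0 : 0 < β := p.lo_pos.trans hβ.1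
      have hm : Measurable fun h => ∫⁻ x, E (x, p.gain n, h, β) := by
        have h1 : Measurable fun z : ℂ × ℝ => E (z.1, p.gain n, z.2, β) := hE.comp (by fun_prop)
        exact h1.lintegral_prod_left'
      rw [lintegral_expMeasure_one hm, setLIntegral_congr_fun measurableSet_Ioi fun h hh => by
        rw [hvol n h β hh hβ0], lintegral_exp_neg_mul_disc (inv_pos.2 hu) (by positivity), inv_inv]
      congr 1
      ring
    rw [hswap, lintegral_exponentLaw, setLIntegral_congr_fun measurableSet_Ioc hβ,
      ENNReal.ofReal_mul (p := 1 / (2 * √3 * p.sd)) (by have := p.sd_pos; positivity),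
      ← intervalIntegral.integral_const_mul, intervalIntegral.integral_of_le hlohi,
      ofReal_integral_eq_lintegral_ofReal]
    · exact (((p.continuousOn_rpow_mul_Gamma hu).const_smul
        (2 * Real.pi)).integrableOn_Icc).mono_set Ioc_subset_Icc_self
    · refine (ae_restrict_iff' measurableSet_Ioc).2 (ae_of_all _ fun β hβ => ?_)
      exact mul_nonneg (by positivity) (p.rpow_mul_Gamma_nonneg hu (Ioc_subset_Icc_self hβ))
  have hnn : ∀ n, 0 ≤ ∫ β in p.lo..p.hi,
      (t / (p.PT * p.gain n)) ^ (-(2 / β)) * Real.Gamma (2 / β) / β := fun n =>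
    intervalIntegral.integral_nonneg hlohi fun β hβ =>
      p.rpow_mul_Gamma_nonneg (div_pos ht (mul_pos p.PT_pos (p.gain_pos n))) hβ
  have hmark : ∀ x, ∫⁻ a, indicator {y : ℂ × p.Mark | t < p.power y.1 y.2} 1 (x, a) ∂p.markLaw =
      ∑ n, ENNReal.ofReal (p.gainProb n) *
        ∫⁻ h, ∫⁻ β, E (x, p.gain n, h, β) ∂p.exponentLaw ∂(expMeasure 1) := fun x =>
    p.lintegral_markLaw (p.sectionOf x) (f := fun z => E (x, z)) (hE.comp (by fun_prop))
  have hsd := p.sd_pos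
  have hin : ∀ n, Measurable fun x =>
      ∫⁻ h, ∫⁻ β, E (x, p.gain n, h, β) ∂p.exponentLaw ∂(expMeasure 1) := by
    intro n
    have h1 : Measurable fun z : (ℂ × ℝ) × ℝ => E (z.1.1, p.gain n, z.1.2, z.2) :=
      hE.comp (by fun_prop)
    exact h1.lintegral_prod_right'.lintegral_prod_right'
  rw [← lintegral_indicator_one hmeas, p.lintegral_intensity (measurable_one.indicator hmeas)]
  simp_rw [hmark]
  rw [lintegral_finsetSum _ fun n _ => (hin n).const_mul _]
  simp_rw [lintegral_const_mul _ (hin _), hn]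
  rw [meanAbove, Finset.mul_sum, Finset.mul_sum, ENNReal.ofReal_sum_of_nonneg]
  · refine Finset.sum_congr rfl fun n _ => ?_
    rw [← ENNReal.ofReal_mul (p.gainProb_nonneg n), ← ENNReal.ofReal_mul p.lam_pos.le]
    congr 1
    field_simp
  · intro n _
    have := p.gainProb_nonneg n
    have := p.lam_pos
    have := hnn n
    positivity

end Params

/-! ### The association probability at a fixed location -/

namespace Params

variable (p : Params)

theorem meanAbove_nonneg {t : ℝ} (ht : 0 < t) : 0 ≤ p.meanAbove t := by
  have h1 := p.lam_pos
  have h2 := p.sd_pos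
  refine mul_nonneg (by positivity) (Finset.sum_nonneg fun n _ =>
    mul_nonneg (p.gainProb_nonneg n) ?_)
  exact intervalIntegral.integral_nonneg (sub_pos.1 p.hi_sub_lo_pos).le fun β hβ =>
    p.rpow_mul_Gamma_nonneg (div_pos ht (mul_pos p.PT_pos (p.gain_pos n))) hβ

theorem assocFormula_nonneg (r : ℝ) : 0 ≤ p.assocFormula r := by
  have hsd := p.sd_pos
  refine Finset.sum_nonneg fun m _ => mul_nonneg
    (div_nonneg (p.gainProb_nonneg m) (by positivity)) ?_
  exact integral_nonneg fun h => intervalIntegral.integral_nonneg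
    (sub_pos.1 p.hi_sub_lo_pos).le fun α _ => (Real.exp_pos _).le

/-- The formula `assocFormula` written with Lebesgue integrals of the void probability
`exp (-meanAbove t)` of the powers above the level `t`. -/
theorem lintegral_power_markLaw {F : ℝ → ℝ≥0∞} (hF : Measurable F)
    (hFt : ∀ t, 0 < t → F t = ENNReal.ofReal (Real.exp (-p.meanAbove t))) {x : ℂ} (hx : x ≠ 0) :
    ∫⁻ a, F (p.power x a) ∂p.markLaw = ENNReal.ofReal (p.assocFormula ‖x‖) := by
  have hr : 0 < ‖x‖ := norm_pos_iff.2 hx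
  have hsd := p.sd_pos
  have hlohi : p.lo ≤ p.hi := (sub_pos.1 p.hi_sub_lo_pos).le
  let f : Fin 4 → ℝ → ℝ → ℝ≥0∞ := fun m h α =>
    ENNReal.ofReal (Real.exp (-h)) * F (p.PT * p.gain m * h * ‖x‖ ^ (-α))
  have hpow : ∀ m, ∀ h ∈ Ioi (0 : ℝ), ∀ α : ℝ, 0 < p.PT * p.gain m * h * ‖x‖ ^ (-α) :=
    fun m h hh α => mul_pos (mul_pos (mul_pos p.PT_pos (p.gain_pos m)) hh)
      (Real.rpow_pos_of_pos hr _)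
  have hfm : ∀ m, Measurable fun z : ℝ × ℝ => f m z.1 z.2 := by
    intro m
    have h1 : Measurable fun z : ℝ × ℝ => F (p.PT * p.gain m * z.1 * ‖x‖ ^ (-z.2)) :=
      hF.comp (by fun_prop)
    have h2 : Measurable fun z : ℝ × ℝ => ENNReal.ofReal (Real.exp (-z.1)) := by fun_prop
    exact h2.mul h1
  let I : Fin 4 → ℝ≥0∞ := fun m => ∫⁻ h in Ioi (0 : ℝ), ∫⁻ α in Ioc p.lo p.hi, f m h α
  have hinner : ∀ m, ∀ h ∈ Ioi (0 : ℝ), ∀ α, f m h α = ENNReal.ofReal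
      (Real.exp (-h - p.meanAbove (p.PT * p.gain m * h * ‖x‖ ^ (-α)))) := by
    intro m h hh α
    simp only [f]
    rw [hFt _ (hpow m h hh α), ← ENNReal.ofReal_mul (Real.exp_pos _).le, ← Real.exp_add,
      ← sub_eq_add_neg]
  have hle : ∀ m, ∀ h ∈ Ioi (0 : ℝ), ∀ α, f m h α ≤ ENNReal.ofReal (Real.exp (-h)) := by
    intro m h hh α
    rw [hinner m h hh]
    refine ENNReal.ofReal_le_ofReal (Real.exp_le_exp.2 ?_)
    have := p.meanAbove_nonneg (hpow m h hh α)
    linarith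
  have hIoc : ∀ m, ∀ h ∈ Ioi (0 : ℝ), ∫⁻ α in Ioc p.lo p.hi, f m h α ≤
      ENNReal.ofReal (Real.exp (-h)) * ENNReal.ofReal (p.hi - p.lo) := by
    intro m h hh
    refine (lintegral_mono fun α => hle m h hh α).trans ?_
    rw [setLIntegral_const, Real.volume_Ioc]
  have hItop : ∀ m, I m ≠ ⊤ := by
    intro m
    refine ne_top_of_le_ne_top ?_ (setLIntegral_mono' measurableSet_Ioi (hIoc m))
    rw [lintegral_mul_const' _ _ ENNReal.ofReal_ne_top]
    have h1 := lintegral_exp_neg_mul_rpow (s := 0) (by norm_num)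
    simp only [Real.rpow_zero, mul_one] at h1
    rw [h1]
    exact ENNReal.mul_ne_top ENNReal.ofReal_ne_top ENNReal.ofReal_ne_top
  have hformula : p.assocFormula ‖x‖ =
      ∑ m, p.gainProb m / (2 * √3 * p.sd) * (I m).toReal := by
    unfold assocFormula
    refine Finset.sum_congr rfl fun m _ => ?_
    congr 1
    have hm : Measurable fun h => ∫⁻ α in Ioc p.lo p.hi, f m h α := (hfm m).lintegral_prod_right'
    rw [← integral_toReal hm.aemeasurable]
    · refine setIntegral_congr_fun measurableSet_Ioi fun h hh => ?_
      have hmh : Measurable fun α => f m h α := (hfm m).comp measurable_prodMk_left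
      rw [← integral_toReal hmh.aemeasurable, intervalIntegral.integral_of_le hlohi]
      · refine setIntegral_congr_fun measurableSet_Ioc fun α _ => ?_
        rw [hinner m h hh, ENNReal.toReal_ofReal (Real.exp_pos _).le, meanAbove]
        congr 4
        ext n
        congr 2
        ext β
        congr 3
        have h1 := p.PT_pos.ne'
        have h2 := (p.gain_pos n).ne'
        field_simp
      · exact ae_of_all _ fun α => (hle m h hh α).trans_lt ENNReal.ofReal_lt_top
    · exact (ae_restrict_iff' measurableSet_Ioi).2 (ae_of_all _ fun h hh =>
        (hIoc m h hh).trans_lt (ENNReal.mul_lt_top ENNReal.ofReal_lt_top ENNReal.ofReal_lt_top))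
  have hz : Measurable fun z : ℝ × ℝ × ℝ => F (p.PT * z.1 * z.2.1 * ‖x‖ ^ (-z.2.2)) :=
    hF.comp (by fun_prop)
  have hmark : ∫⁻ a, F (p.power x a) ∂p.markLaw =
      ∑ m, ENNReal.ofReal (p.gainProb m) * (ENNReal.ofReal (1 / (2 * √3 * p.sd)) * I m) := by
    refine (p.lintegral_markLaw (p.sectionOf x) hz).trans (Finset.sum_congr rfl fun m _ => ?_)
    congr 1
    simp_rw [lintegral_exponentLaw]
    have h1 : Measurable fun z : ℝ × ℝ => F (p.PT * p.gain m * z.1 * ‖x‖ ^ (-z.2)) :=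
      hF.comp (by fun_prop)
    have h2 : Measurable fun h => ∫⁻ α in Ioc p.lo p.hi, F (p.PT * p.gain m * h * ‖x‖ ^ (-α)) :=
      h1.lintegral_prod_right'
    rw [lintegral_const_mul _ h2, lintegral_expMeasure_one h2]
    congr 1
    refine lintegral_congr fun h => ?_
    exact (lintegral_const_mul' _ _ ENNReal.ofReal_ne_top).symm
  rw [hmark, hformula, ENNReal.ofReal_sum_of_nonneg]
  · refine Finset.sum_congr rfl fun m _ => ?_
    rw [← mul_assoc, ← ENNReal.ofReal_mul (p.gainProb_nonneg m), mul_one_div,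
      ENNReal.ofReal_mul (div_nonneg (p.gainProb_nonneg m) (by positivity)),
      ENNReal.ofReal_toReal (hItop m)]
  · exact fun m _ => mul_nonneg (div_nonneg (p.gainProb_nonneg m) (by positivity))
      ENNReal.toReal_nonneg

end Params

section Network

variable {p : Params} {Ω : Type*} [MeasurableSpace Ω] {P : Measure Ω} [IsProbabilityMeasure P]
  {X : ℕ → Ω → ℂ} {mark : ℕ → Ω → p.Mark}

/-- The law of the maximal received power. -/
theorem IsNetwork.measure_forall_power_le (h : IsNetwork p P X mark) {t : ℝ} (ht : 0 < t) :
    P {ω | ∀ j, p.power (X j ω) (mark j ω) ≤ t} = ENNReal.ofReal (Real.exp (-p.meanAbove t)) := by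
  have h1 := h.measure_void (measurableSet_lt measurable_const p.measurable_power)
    ((p.intensity_lt_power ht).trans_ne ENNReal.ofReal_ne_top)
  rw [p.intensity_lt_power ht, ENNReal.toReal_ofReal (p.meanAbove_nonneg ht)] at h1
  simpa only [mem_ofPred_eq, not_lt] using h1

theorem IsNetwork.lintegral_forall_power_le (h : IsNetwork p P X mark) {x : ℂ} (hx : x ≠ 0) :
    ∫⁻ a, P {ω | ∀ j, p.power (X j ω) (mark j ω) ≤ p.power x a} ∂p.markLaw =
      ENNReal.ofReal (p.assocFormula ‖x‖) :=
  p.lintegral_power_markLaw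
    (monotone_measure_forall_le P X mark fun y => p.power y.1 y.2).measurable
    (fun _ ht => h.measure_forall_power_le ht) hx

theorem IsNetwork.measure_forall_power_le_extra (h : IsNetwork p P X mark) {mark₀ : Ω → p.Mark}
    (h₀ : IsExtraMark p P X mark mark₀) {x : ℂ} (hx : x ≠ 0) :
    P {ω | ∀ i, p.power (X i ω) (mark i ω) ≤ p.power x (mark₀ ω)} =
      ENNReal.ofReal (p.assocFormula ‖x‖) := by
  have hY : Measurable fun ω i => (X i ω, mark i ω) := measurable_pi_lambda _ h.measurable_pair
  have hprod := (indepFun_iff_map_prod_eq_prod_map_map h₀.measurable.aemeasurable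
    hY.aemeasurable).1 h₀.indep
  have hpx : Measurable fun a : p.Mark => p.power x a :=
    p.measurable_power.comp measurable_prodMk_left
  have hS : MeasurableSet {z : p.Mark × (ℕ → ℂ × p.Mark) |
      ∀ i, p.power (z.2 i).1 (z.2 i).2 ≤ p.power x z.1} := by
    simp only [ofPred_forall]
    refine MeasurableSet.iInter fun i => measurableSet_le ?_ (hpx.comp measurable_fst)
    exact p.measurable_power.comp ((measurable_pi_apply i).comp measurable_snd)
  have := Measure.isProbabilityMeasure_map (μ := P) hY.aemeasurable
  have h1 : P {ω | ∀ i, p.power (X i ω) (mark i ω) ≤ p.power x (mark₀ ω)} =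
      P.map (fun ω => (mark₀ ω, fun i => (X i ω, mark i ω)))
        {z | ∀ i, p.power (z.2 i).1 (z.2 i).2 ≤ p.power x z.1} :=
    (Measure.map_apply (h₀.measurable.prodMk hY) hS).symm
  rw [h1, hprod, Measure.prod_apply hS, h₀.law, ← h.lintegral_forall_power_le hx]
  refine lintegral_congr fun a => ?_
  rw [Measure.map_apply hY (measurable_prodMk_left hS)]
  rfl

/-! ### The expected number of serving stations -/

theorem lintegral_comp_norm {g : ℝ → ℝ≥0∞} (hg : Measurable g) :
    ∫⁻ x : ℂ, g ‖x‖ = ∫⁻ r in Ioi (0 : ℝ), ENNReal.ofReal (2 * Real.pi * r) * g r := by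
  have hm : Measurable fun z : ℝ × ℝ => ENNReal.ofReal z.1 * g |z.1| :=
    (ENNReal.measurable_ofReal.comp measurable_fst).mul
      (hg.comp (measurable_norm.comp measurable_fst))
  rw [← Complex.lintegral_comp_polarCoord_symm]
  simp_rw [Complex.norm_polarCoord_symm, smul_eq_mul]
  rw [polarCoord_target, Measure.volume_eq_prod, ← Measure.prod_restrict,
    lintegral_prod _ hm.aemeasurable]
  refine setLIntegral_congr_fun measurableSet_Ioi fun r hr => ?_
  simp only
  rw [setLIntegral_const, Real.volume_Ioo, abs_of_pos hr, mul_right_comm, sub_neg_eq_add,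
    ← two_mul, mul_comm (ENNReal.ofReal r), ← ENNReal.ofReal_mul (by positivity)]

theorem IsNetwork.tsum_measure_serving (h : IsNetwork p P X mark) {B : Set ℝ}
    (hB : MeasurableSet B) (hB0 : B ⊆ Ioi 0) :
    ∑' i, P {ω | ‖X i ω‖ ∈ B ∧ ∀ j, p.power (X j ω) (mark j ω) ≤ p.power (X i ω) (mark i ω)} =
      ∫⁻ r in B, ENNReal.ofReal (p.assocFormula r * (2 * Real.pi * p.lam * r)) := by
  let T : ℂ × p.Mark → ℝ := fun y => p.power y.1 y.2
  have hT : Measurable T := p.measurable_power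
  let F : ℝ → ℝ≥0∞ := fun t => P {ω | ∀ j, T (X j ω, mark j ω) ≤ t}
  have hF : Measurable F := (monotone_measure_forall_le P X mark T).measurable
  have hA : MeasurableSet {y : ℂ × p.Mark | ‖y.1‖ ∈ B} :=
    (measurable_norm.comp measurable_fst) hB
  have hne : ∀ x : ℂ, ‖x‖ ∈ B → x ≠ 0 := fun x hx => norm_pos_iff.1 (hB0 hx)
  have hnull : p.intensity ({y : ℂ × p.Mark | ‖y.1‖ ∈ B} ∩ {y | T y ≤ 0}) = 0 := by
    have hm : MeasurableSet ({y : ℂ × p.Mark | ‖y.1‖ ∈ B} ∩ {y | T y ≤ 0}) :=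
      hA.inter (measurableSet_le hT measurable_const)
    rw [← lintegral_indicator_one hm, p.lintegral_intensity (measurable_one.indicator hm)]
    have h0 : ∀ x, ∫⁻ a, indicator ({y : ℂ × p.Mark | ‖y.1‖ ∈ B} ∩ {y | T y ≤ 0})
        (1 : ℂ × p.Mark → ℝ≥0∞) (x, a) ∂p.markLaw = 0 := by
      intro x
      refine (lintegral_congr_ae (g := fun _ => 0) ?_).trans lintegral_zero
      by_cases hx : ‖x‖ ∈ B
      · filter_upwards [p.ae_power_pos (hne x hx)] with a ha
        exact indicator_of_notMem (fun hc => not_le.2 ha hc.2) _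
      · exact ae_of_all _ fun a => indicator_of_notMem (fun hc => hx hc.1) _
    simp_rw [h0, lintegral_zero, mul_zero]
  have hmecke := h.tsum_measure_mem_max hT
    (fun t ht => (p.intensity_lt_power ht).trans_ne ENNReal.ofReal_ne_top) hA hnull
  refine hmecke.trans ?_
  have hFT : Measurable fun y => F (T y) := hF.comp hT
  rw [← lintegral_indicator hA, p.lintegral_intensity (hFT.indicator hA)]
  -- a measurable version of the association probability as a function of the distance
  let g : ℝ → ℝ≥0∞ := fun r => ∫⁻ a, F (T ((r : ℂ), a)) ∂p.markLaw
  have hg : Measurable g := by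
    have h1 : Measurable fun z : ℝ × p.Mark => F (T ((z.1 : ℂ), z.2)) :=
      hFT.comp ((Complex.measurable_ofReal.comp measurable_fst).prodMk measurable_snd)
    exact h1.lintegral_prod_right'
  have hgr : ∀ r ∈ B, g r = ENNReal.ofReal (p.assocFormula r) := by
    intro r hr
    have h0 : 0 < r := hB0 hr
    have h1 := h.lintegral_forall_power_le (x := (r : ℂ)) (Complex.ofReal_ne_zero.2 h0.ne')
    rw [Complex.norm_real, Real.norm_of_nonneg h0.le] at h1
    exact h1
  have hx : ∀ x : ℂ, ∫⁻ a, indicator {y : ℂ × p.Mark | ‖y.1‖ ∈ B} (fun y => F (T y)) (x, a)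
      ∂p.markLaw = indicator B g ‖x‖ := by
    intro x
    by_cases hxB : ‖x‖ ∈ B
    · rw [indicator_of_mem hxB, hgr _ hxB, ← h.lintegral_forall_power_le (hne x hxB)]
      refine lintegral_congr fun a => ?_
      rw [indicator_of_mem (show (x, a) ∈ {y : ℂ × p.Mark | ‖y.1‖ ∈ B} from hxB)]
    · rw [indicator_of_notMem hxB]
      refine (lintegral_congr fun a => ?_).trans lintegral_zero
      exact indicator_of_notMem (show (x, a) ∉ {y : ℂ × p.Mark | ‖y.1‖ ∈ B} from hxB) _
  simp_rw [hx]
  rw [lintegral_comp_norm (hg.indicator hB), ← lintegral_const_mul' _ _ ENNReal.ofReal_ne_top,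
    ← lintegral_indicator measurableSet_Ioi, ← lintegral_indicator hB]
  refine lintegral_congr fun r => ?_
  by_cases hr : r ∈ B
  · have h0 : 0 < r := hB0 hr
    rw [indicator_of_mem (show r ∈ Ioi (0 : ℝ) from h0), indicator_of_mem hr, indicator_of_mem hr,
      hgr r hr, mul_comm (p.assocFormula r), ENNReal.ofReal_mul
        (mul_nonneg (mul_nonneg (by positivity) p.lam_pos.le) h0.le), ← mul_assoc,
      ← ENNReal.ofReal_mul p.lam_pos.le]
    congr 2
    ring
  · rw [indicator_of_notMem hr]
    by_cases h0 : r ∈ Ioi (0 : ℝ)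
    · rw [indicator_of_mem h0, indicator_of_notMem hr, mul_zero, mul_zero]
    · rw [indicator_of_notMem h0]

end Network

end SmallCell

end

/-- The association probability under association by maximum received power. First part: a base
station at a given location at distance `r` from the user, together with the Poisson network of the
other stations. Second part: the same function of `r` is the conditional (Palm) probability that a
station of the Poisson network itself, given that it is at distance `r`, is the serving one: the
expected number of serving stations at a distance in `B` is the integral over `B` of this function
against the intensity `2πλr dr` of the distances. -/
theorem theorem4 (p : SmallCell.Params) {Ω : Type*} [MeasurableSpace Ω] (P : Measure Ω)
    [IsProbabilityMeasure P] (X : ℕ → Ω → ℂ) (mark : ℕ → Ω → p.Mark)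
    (hnet : SmallCell.IsNetwork p P X mark) :
    (∀ (r : ℝ) (x₀ : ℂ) (mark₀ : Ω → p.Mark), 0 < r → ‖x₀‖ = r →
      SmallCell.IsExtraMark p P X mark mark₀ →
      P.real {ω | ∀ i, p.power (X i ω) (mark i ω) ≤ p.power x₀ (mark₀ ω)} = p.assocFormula r) ∧
    (∀ B : Set ℝ, MeasurableSet B → B ⊆ Ioi 0 →
      ∑' i, P {ω | ‖X i ω‖ ∈ B ∧
          ∀ j, p.power (X j ω) (mark j ω) ≤ p.power (X i ω) (mark i ω)} =
        ∫⁻ r in B, ENNReal.ofReal (p.assocFormula r * (2 * Real.pi * p.lam * r))) := by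
  refine ⟨fun r x₀ mark₀ hr hx₀ h₀ => ?_, fun B hB hB0 => hnet.tsum_measure_serving hB hB0⟩
  have hx : x₀ ≠ 0 := norm_pos_iff.1 (hx₀ ▸ hr)
  rw [measureReal_def, hnet.measure_forall_power_le_extra h₀ hx, hx₀,
    ENNReal.toReal_ofReal (p.assocFormula_nonneg r)]
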